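/- Let $R$ be a two-sided noetherian ring (not necessarily commutative) and let $\mathcal K(R)=\mathcal K(\operatorname{proj} R)$ be the homotopy category of (unbounded) complexes of finitely generated projective right $R$-modules, with its usual triangulated structure; $\mathcal K(R^{\mathrm{op}})$ is the same for left modules. We use the following notions. * For a complex $X$, $\mathrm H^i(X)$ is its $i$th cohomology, $C^i(X)=\operatorname{Coker}(d_X^{i-1}:X^{i-1}\to X^i)$, and $X^\ast=\operatorname{Hom}_R(X,R)$ is its $R$-dual, with $(X^\ast)^i=(X^{-i})^\ast$. * A morphism $f$ of $\mathcal K(R)$ is cohomologically surjective if $\mathrm H^i(f)$ is surjective for all $i\in\mathbb Z$. A distinguished triangle $X\to Y\to Z\to X[1]$ in $\mathcal K(R)$ is cohomologically ghost if $0\to \mathrm H^i(X)\to \mathrm H^i(Y)\to \mathrm H^i(Z)\to 0$ is exact for all $i\in\mathbb Z$. * $\operatorname{Add} R$ is the smallest full subcategory of $\mathcal K(R)$ that contains $R$ (in degree $0$) and is closed under shifts, direct summands and all coproducts that exist in $\mathcal K(R)$. A right $\operatorname{Add} R$-approximation of $X$ is a morphism $p:P\to X$ with $P\in\operatorname{Add}R$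 such that every morphism $W\to X$ with $W\in\operatorname{Add}R$ factors through $p$. A syzygy $\Omega X$ is the cocone of a right $\operatorname{Add} R$-approximation, so that there is a distinguished triangle $\Omega X\to P\xrightarrow{p}X\to\Omega X[1]$; put $\Omega^0X=X$ and $\Omega^{n}X=\Omega(\Omega^{n-1}X)$. * A complex $X$ is split if there are homomorphisms $s^i:X^i\to X^{i-1}$ with $d_X^i s^{i+1}d_X^i=d_X^i$ for all $i$. The projective dimension $\operatorname{pd}X\in\{0,1,2,\dots,\infty\}$ is the infimum of the integers $m\ge 0$ for which there are distinguished triangles $X_{i+1}\to P_i\xrightarrow{f_i}X_i\to X_{i+1}[1]$ ($0\le i\le m-1$) in $\mathcal K(R)$ with $P_i$ split and $f_i$ cohomologically surjective, $X_0\cong X$ in $\mathcal K(R)$ and $X_m$ split. * For $n\ge 1$, $X\in\mathcal K(R)$ is $n$-torsionfree if $\operatorname{Ext}^j_{R^{\mathrm{op}}}(C^i(X^\ast),R)=0$ for all $i\in\mathbb Z$ and $1\le j\le n$; the same definition is used over $R^{\mathrm{op}}$. Theorem. Let $X\in\mathcal K(R)$ and let $n\geq 1$ be an integer. Then $X$ has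 an $n$th syzygy, and for every choice of an $n$th syzygy $\Omega^nX$ (that is, of the approximations and cocones used to form it) the following are equivalent: (1) $\Omega^n X$ is $n$-torsionfree; (2) there exists a cohomologically ghost triangle $Y\to G\to X\to Y[1]$ in $\mathcal K(R)$ such that $G^\ast\in\mathcal K(R^{\mathrm{op}})$ is $n$-torsionfree and $\operatorname{pd} Y\le n-1$. -/

import Mathlib

open CategoryTheory CategoryTheory.Limits CategoryTheory.Pretriangulated

universe u

noncomputable section

namespace StableComplex

/-! Left modules over a ring `A` are `ModuleCat A`; right modules over `R` are `ModuleCat Rᵐᵒᵖ`. -/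

/-- The finitely generated projective modules. -/
def isFGProj (A : Type u) [Ring A] : ObjectProperty (ModuleCat.{u} A) :=
  fun M => Module.Finite A M ∧ Module.Projective A M

instance isFGProj_containsZero (A : Type u) [Ring A] : (isFGProj A).ContainsZero where
  exists_zero := ⟨ModuleCat.of A PUnit.{u + 1}, ModuleCat.isZero_of_subsingleton _,
    inferInstanceAs (Module.Finite A PUnit.{u + 1}),
    inferInstanceAs (Module.Projective A PUnit.{u + 1})⟩

lemma isFGProj_of_linearEquiv {A : Type u} [Ring A] {M : ModuleCat.{u} A} {N : Type u}
    [AddCommGroup N] [Module A N] [Module.Finite A N] [Module.Projective A N] (e : N ≃ₗ[A] M) :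
    isFGProj A M :=
  ⟨Module.Finite.equiv e, Module.Projective.of_equiv e⟩

lemma projective_pi {A : Type u} [Ring A] {J : Type*} [Fintype J] (F : J → Type u)
    [∀ j, AddCommGroup (F j)] [∀ j, Module A (F j)] [∀ j, Module.Projective A (F j)] :
    Module.Projective A (∀ j, F j) := by
  classical
  exact Module.Projective.of_equiv (DirectSum.linearEquivFunOnFintype A J F)

instance isFGProj_closedUnderFiniteProducts (A : Type u) [Ring A] :
    (isFGProj A).IsClosedUnderFiniteProducts where
  isClosedUnderLimitsOfShape J _ := by
    have := Fintype.ofFinite J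
    refine ⟨?_⟩
    rintro M ⟨p⟩
    have h1 : ∀ j, Module.Finite A (p.diag.obj ⟨j⟩) := fun j => (p.prop_diag_obj ⟨j⟩).1
    have h2 : ∀ j, Module.Projective A (p.diag.obj ⟨j⟩) := fun j => (p.prop_diag_obj ⟨j⟩).2
    let F : J → ModuleCat.{u} A := fun j => p.diag.obj ⟨j⟩
    let e₁ : M ≅ limit (Discrete.functor F) :=
      (p.isLimit.conePointsIsoOfNatIso (limit.isLimit _) Discrete.natIsoFunctor)
    let e₂ : (∏ᶜ F) ≅ ModuleCat.of A (∀ j, F j) := ModuleCat.piIsoPi F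
    have : Module.Projective A (∀ j, F j) :=
      projective_pi (fun j => F j)
    exact isFGProj_of_linearEquiv (e₁ ≪≫ e₂).symm.toLinearEquiv

/-- The category `proj A` of finitely generated projective modules. -/
abbrev FGProj (A : Type u) [Ring A] := (isFGProj A).FullSubcategory

instance fgProj_hasBinaryBiproducts (A : Type u) [Ring A] : HasBinaryBiproducts (FGProj A) :=
  HasBinaryBiproducts.of_hasBinaryProducts

/-- The homotopy category `K(proj A)` of complexes of finitely generated projective modules. It
carries Mathlib's shift functors and (mapping cone) triangulated structure. -/
abbrev KProj (A : Type u) [Ring A] := HomotopyCategory (FGProj A) (ComplexShape.up ℤ)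

/-- The `i`th cohomology `Hⁱ : K(proj A) ⥤ Mod A`. -/
def cohomology (A : Type u) [Ring A] (i : ℤ) : KProj A ⥤ ModuleCat.{u} A :=
  (isFGProj A).ι.mapHomotopyCategory (ComplexShape.up ℤ) ⋙
    HomotopyCategory.homologyFunctor (ModuleCat.{u} A) (ComplexShape.up ℤ) i

instance cohomology_additive (A : Type u) [Ring A] (i : ℤ) : (cohomology A i).Additive := by
  unfold cohomology; infer_instance

/-- A morphism of `K(proj A)` which is surjective on all cohomology modules. -/
def IsCohSurjective {A : Type u} [Ring A] {X Y : KProj A} (f : X ⟶ Y) : Prop :=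
  ∀ i : ℤ, Function.Surjective ((cohomology A i).map f)

/-- A triangle `X ⟶ Y ⟶ Z ⟶ X[1]` is cohomologically ghost if it is distinguished and
`0 ⟶ Hⁱ(X) ⟶ Hⁱ(Y) ⟶ Hⁱ(Z) ⟶ 0` is exact for all `i`. -/
def IsCohGhost {A : Type u} [Ring A] (T : Triangle (KProj A)) : Prop :=
  ∃ hT : T ∈ distTriang (KProj A), ∀ i : ℤ,
    ((ShortComplex.mk T.mor₁ T.mor₂ (comp_distTriang_mor_zero₁₂ T hT)).map
      (cohomology A i)).ShortExact

/-! ### `Add A`, approximations and syzygies -/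

/-- The regular module, as an object of `proj A`. -/
def regular (A : Type u) [Ring A] : FGProj A :=
  ⟨ModuleCat.of A A, inferInstanceAs (Module.Finite A A), inferInstanceAs (Module.Projective A A)⟩

/-- The conditions on a full subcategory of `K(proj A)` in the definition of `Add A`: it contains
the regular module in degree `0`, and is closed under shifts, direct summands (a retract in a
triangulated category is the same as a direct summand) and existing coproducts. -/
structure IsAddClosed {A : Type u} [Ring A] (P : ObjectProperty (KProj A)) : Prop where
  unit : P ((HomotopyCategory.quotient (FGProj A) (ComplexShape.up ℤ)).obj
    ((HomologicalComplex.single (FGProj A) (ComplexShape.up ℤ) 0).obj (regular A)))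
  shift : ∀ (X : KProj A) (n : ℤ), P X → P (X⟦n⟧)
  summand : ∀ X Y : KProj A, Nonempty (Retract X Y) → P Y → P X
  coproduct : ∀ (J : Type u) (X : J → KProj A) (c : Cofan X), Nonempty (IsColimit c) →
    (∀ j, P (X j)) → P c.pt

/-- `Add A`, the intersection of all full subcategories with the above closure conditions. -/
def addSubcategory (A : Type u) [Ring A] : ObjectProperty (KProj A) :=
  fun X => ∀ P : ObjectProperty (KProj A), IsAddClosed P → P X

/-- `p : P ⟶ X` is a right `Add A`-approximation of `X`. -/
def IsRightAddApprox {A : Type u} [Ring A] {P X : KProj A} (p : P ⟶ X) : Prop :=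
  addSubcategory A P ∧
    ∀ W : KProj A, addSubcategory A W → ∀ g : W ⟶ X, ∃ h : W ⟶ P, h ≫ p = g

/-- `W` is a syzygy `Ω X` of `X`: the cocone of some right `Add A`-approximation of `X`. -/
def IsSyzygy {A : Type u} [Ring A] (X W : KProj A) : Prop :=
  ∃ (P : KProj A) (q : W ⟶ P) (p : P ⟶ X) (δ : X ⟶ W⟦(1 : ℤ)⟧),
    IsRightAddApprox p ∧ Triangle.mk q p δ ∈ distTriang (KProj A)

/-- `W` is an `n`th syzygy `Ωⁿ X` of `X`, for some choice of the approximations: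
`Ω⁰ X = X` (up to isomorphism) and `Ωⁿ⁺¹ X = Ω (Ωⁿ X)`. -/
def IsNthSyzygy {A : Type u} [Ring A] : ℕ → KProj A → KProj A → Prop
  | 0, X, W => Nonempty (W ≅ X)
  | n + 1, X, W => ∃ V : KProj A, IsNthSyzygy n X V ∧ IsSyzygy V W

/-! ### Split complexes and projective dimension -/

/-- A complex is split if there are maps `sⁱ⁺¹ : Xⁱ⁺¹ ⟶ Xⁱ` with `d s d = d`. -/
def IsSplit {A : Type u} [Ring A] (X : KProj A) : Prop :=
  ∃ s : ∀ i : ℤ, X.as.X (i + 1) ⟶ X.as.X i,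
    ∀ i : ℤ, X.as.d i (i + 1) ≫ s i ≫ X.as.d i (i + 1) = X.as.d i (i + 1)

/-- There are triangles `Xᵢ₊₁ ⟶ Pᵢ ⟶ Xᵢ ⟶ Xᵢ₊₁[1]` for `0 ≤ i < n`, with `Pᵢ` split and
`Pᵢ ⟶ Xᵢ` cohomologically surjective, such that `X₀ ≅ X` and `Xₙ` is split. -/
def HasSplitResolution {A : Type u} [Ring A] (n : ℕ) (X : KProj A) : Prop :=
  ∃ Z : ℕ → KProj A, Nonempty (Z 0 ≅ X) ∧ IsSplit (Z n) ∧
    ∀ i < n, ∃ (P : KProj A) (g : Z (i + 1) ⟶ P) (f : P ⟶ Z i) (δ : Z i ⟶ (Z (i + 1))⟦(1 : ℤ)⟧),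
      Triangle.mk g f δ ∈ distTriang (KProj A) ∧ IsSplit P ∧ IsCohSurjective f

/-- The projective dimension of a complex (`⊤` if there is no such finite resolution). -/
def projDim {A : Type u} [Ring A] (X : KProj A) : ℕ∞ :=
  sInf {m : ℕ∞ | ∃ n : ℕ, m = n ∧ HasSplitResolution n X}

/-! ### Duality and torsionfreeness

For a bimodule `E` over two rings `A`, `B` with commuting actions, finitely generated projective
over `B`, we use the functor `Hom_A(-, E)` from complexes over `proj A` to complexes over `proj B`.
For `E = R` and `(A, B) = (Rᵐᵒᵖ, R)`, resp. `(A, B) = (R, Rᵐᵒᵖ)`, this is the `R`-dual of complexes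
of right, resp. left, `R`-modules. -/

instance finite_op_self (R : Type u) [Ring R] : Module.Finite Rᵐᵒᵖ R :=
  Module.Finite.equiv (MulOpposite.opLinearEquiv Rᵐᵒᵖ : R ≃ₗ[Rᵐᵒᵖ] Rᵐᵒᵖ).symm

instance projective_op_self (R : Type u) [Ring R] : Module.Projective Rᵐᵒᵖ R :=
  Module.Projective.of_equiv (MulOpposite.opLinearEquiv Rᵐᵒᵖ : R ≃ₗ[Rᵐᵒᵖ] Rᵐᵒᵖ).symm

section Dual

variable (A B E : Type u) [Ring A] [Ring B] [AddCommGroup E] [Module A E] [Module B E]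
  [SMulCommClass A B E] [Module.Finite B E] [Module.Projective B E]

lemma dual_fgProj (M : Type u) [AddCommGroup M] [Module A M] [Module.Finite A M]
    [Module.Projective A M] :
    Module.Finite B (M →ₗ[A] E) ∧ Module.Projective B (M →ₗ[A] E) := by
  obtain ⟨n, f, hf⟩ := Module.Finite.exists_fin' A M
  obtain ⟨s, hs⟩ := Module.projective_lifting_property f LinearMap.id hf
  have e : (Fin n → E) ≃ₗ[B] ((Fin n → A) →ₗ[A] E) := (LinearEquiv.piRing A E (Fin n) B).symm
  have : Module.Projective B (Fin n → E) := projective_pi (fun _ => E)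
  have : Module.Finite B ((Fin n → A) →ₗ[A] E) := Module.Finite.equiv e
  have : Module.Projective B ((Fin n → A) →ₗ[A] E) := Module.Projective.of_equiv e
  have h : (LinearMap.lcomp B E s).comp (LinearMap.lcomp B E f) = LinearMap.id := by
    ext φ x
    exact congrArg φ (LinearMap.congr_fun hs x)
  exact ⟨Module.Finite.of_surjective (LinearMap.lcomp B E s)
    (fun φ => ⟨LinearMap.lcomp B E f φ, LinearMap.congr_fun h φ⟩),
    Module.Projective.of_split _ _ h⟩

/-- `Hom_A(M, E)` as an object of `proj B`. -/
def dualObj (M : FGProj A) : FGProj B :=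
  ⟨ModuleCat.of B (M.obj →ₗ[A] E), by
    have := M.property.1
    have := M.property.2
    exact dual_fgProj A B E M.obj⟩

/-- `Hom_A(f, E)`, that is, precomposition with `f`. -/
def dualMap {M N : FGProj A} (f : M ⟶ N) : dualObj A B E N ⟶ dualObj A B E M :=
  ObjectProperty.homMk (ModuleCat.ofHom (LinearMap.lcomp B E f.hom.hom))

lemma dualMap_zero (M N : FGProj A) : dualMap A B E (0 : M ⟶ N) = 0 :=
  ObjectProperty.hom_ext _ (ModuleCat.hom_ext (LinearMap.ext fun φ => LinearMap.comp_zero φ))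

lemma dualMap_comp {M N L : FGProj A} (f : M ⟶ N) (g : N ⟶ L) :
    dualMap A B E (f ≫ g) = dualMap A B E g ≫ dualMap A B E f := rfl

/-- The dual complex: `(X*)ⁱ = Hom_A(X⁻ⁱ, E)`, with differentials the duals of those of `X`. -/
def dualComplex (X : CochainComplex (FGProj A) ℤ) : CochainComplex (FGProj B) ℤ where
  X i := dualObj A B E (X.X (-i))
  d i j := dualMap A B E (X.d (-j) (-i))
  shape i j hij := by
    rw [X.shape (-j) (-i) (fun h => hij (by simp only [ComplexShape.up_Rel] at h ⊢; lia))]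
    exact dualMap_zero A B E _ _
  d_comp_d' i j k _ _ := by
    rw [← dualMap_comp, X.d_comp_d, dualMap_zero]

/-- The dual `X*` of an object of `K(proj A)`. -/
def dual (X : KProj A) : KProj B :=
  (HomotopyCategory.quotient (FGProj B) (ComplexShape.up ℤ)).obj (dualComplex A B E X.as)

end Dual

/-- `Cⁱ(X)`, the cokernel of the differential `Xⁱ⁻¹ ⟶ Xⁱ`. -/
def coker {A : Type u} [Ring A] (X : KProj A) (i : ℤ) : ModuleCat.{u} A :=
  ModuleCat.of A ((X.as.X i).obj ⧸ LinearMap.range (X.as.d (i - 1) i).hom.hom)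

/-- `X` is `n`-torsionfree: `Extʲ_B(Cⁱ(X*), E) = 0` for all `i` and `1 ≤ j ≤ n`. -/
def IsTorsionfree (A B E : Type u) [Ring A] [Ring B] [AddCommGroup E] [Module A E] [Module B E]
    [SMulCommClass A B E] [Module.Finite B E] [Module.Projective B E] (n : ℕ) (X : KProj A) :
    Prop :=
  ∀ (i : ℤ) (j : ℕ), 1 ≤ j → j ≤ n →
    Subsingleton (Abelian.Ext (coker (dual A B E X) i) (ModuleCat.of B E) j)

end StableComplex

end

/-! Split complexes play the role of projectives. Over a noetherian ring they are exactly the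
objects of `Add R` (`addSubcategory_iff`), and a morphism kills every map from a split complex
exactly when it is zero on cohomology (`isGhost_iff`). So cohomologically ghost triangles are those
with ghost connecting morphism, a syzygy is the first term of such a triangle with split middle
term, and `projDim` is the length of a resolution relative to the split complexes.

Two families of conditions are compared. `O j` says that `Extʲ(Cⁱ(G), R) = 0` for all `i`; by
reflexivity of finitely generated projectives, `O 1, ..., O n` mean that the dual of `G` is
`n`-torsionfree. `T j` says that `Extʲ(Cⁱ(W*), R) = 0` for all `i`, so `T 1, ..., T n` mean that `W`
is `n`-torsionfree. Dimension shifting on mapping cones turns `O (j + 2)` of an object into `O (j +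
1)` of its syzygy, and `T (j + 2)` of an object into `T (j + 1)` of its cosyzygy along a left
approximation. At the bottom, `O 1` says that ghosts from `G` to split complexes vanish, and `T 1`
is the dual statement about maps from split complexes to `W`. These are what is needed to make one
triangle serve both as a syzygy and as a left approximation (`IsStrongSyzygy`). All this is
collected in `IsVanishingPair`.

The rest is formal. Start from the extension `0 → W → W` with `W = Ωⁿ X`. `IsGhostExt.ascend`
replaces the right-hand term by the object of which it is a syzygy and the middle term by a
cosyzygy; the left-hand term gains one step of resolution, and one `T` condition on the middle term
is traded for one `O` condition. After `n` steps the right-hand term is `X` and the left-hand term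
has a resolution with `n` terms, that is, length at most `n - 1`. `IsGhostExt.descend` undoes the
steps until the left-hand term is zero, so that the middle term is `W`. -/

noncomputable section

/-! ### Ghosts, approximations and relative syzygies in a triangulated category -/

namespace RelativeSyzygy

open Triangulated ZeroObject

/-- The first `n` members of a sequence of conditions. -/
def UpTo {α : Type*} (O : ℕ → α → Prop) (n : ℕ) (X : α) : Prop := ∀ j : ℕ, 1 ≤ j → j ≤ n → O j X

lemma upTo_zero {α : Type*} (O : ℕ → α → Prop) (X : α) : UpTo O 0 X := fun j h1 h2 => by lia

lemma upTo_succ_iff {α : Type*} {O : ℕ → α → Prop} {n : ℕ} {X W : α}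
    (h : ∀ j, O (j + 1) W ↔ O (j + 2) X) : UpTo O (n + 1) X ↔ O 1 X ∧ UpTo O n W := by
  refine ⟨fun hX => ⟨hX 1 le_rfl (by lia), fun j h1 h2 => ?_⟩, fun hX j h1 h2 => ?_⟩
  · obtain ⟨j, rfl⟩ := Nat.exists_eq_add_of_le' h1
    exact (h j).2 (hX _ (by lia) (by lia))
  · obtain ⟨j, rfl⟩ := Nat.exists_eq_add_of_le' h1
    obtain _ | j := j
    · exact hX.1
    · exact (h j).1 (hX.2 _ (by lia) (by lia))

variable {C : Type*} [Category* C] [Preadditive C] (S : ObjectProperty C)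

/-- Morphisms which vanish on all morphisms from objects of `S`. -/
def IsGhost {X Y : C} (f : X ⟶ Y) : Prop :=
  ∀ ⦃P : C⦄, S P → ∀ g : P ⟶ X, g ≫ f = 0

variable {S}

lemma IsGhost.comp_left {X Y Z : C} {g : Y ⟶ Z} (hg : IsGhost S g) (f : X ⟶ Y) :
    IsGhost S (f ≫ g) := fun _ hP a => by
  rw [← Category.assoc]; exact hg hP _

lemma IsGhost.comp_right {X Y Z : C} {f : X ⟶ Y} (hf : IsGhost S f) (g : Y ⟶ Z) :
    IsGhost S (f ≫ g) := fun _ hP a => by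
  rw [← Category.assoc, hf hP, zero_comp]

variable [HasZeroObject C] [HasShift C ℤ]
  [∀ n : ℤ, (shiftFunctor C n).Additive] [Pretriangulated C]

variable (S)

/-- Closure of a class of objects under binary biproducts, shifts and retracts. -/
structure IsShiftAdditive : Prop where
  biprod : ∀ X Y : C, S X → S Y → S (X ⊞ Y)
  shift : ∀ (X : C) (n : ℤ), S X → S (X⟦n⟧)
  retract : ∀ X Y : C, Nonempty (Retract X Y) → S Y → S X

/-- Left `S`-approximations. -/
def IsLeftApprox {G Q : C} (q : G ⟶ Q) : Prop :=
  S Q ∧ ∀ ⦃P : C⦄, S P → ∀ g : G ⟶ P, ∃ h : Q ⟶ P, q ≫ h = g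

/-- There is a distinguished triangle `Y ⟶ G ⟶ X ⟶ Y⟦1⟧` with ghost connecting morphism. -/
def IsGhostExt (Y G X : C) : Prop :=
  ∃ (f : Y ⟶ G) (g : G ⟶ X) (δ : X ⟶ Y⟦(1 : ℤ)⟧),
    Triangle.mk f g δ ∈ distTriang C ∧ IsGhost S δ

/-- `W` is a syzygy of `X` relative to `S`. -/
def IsRelSyzygy (W X : C) : Prop := ∃ P : C, S P ∧ IsGhostExt S W P X

/-- `W` is a relative syzygy of `X` through a left `S`-approximation of `W`. -/
def IsStrongSyzygy (W X : C) : Prop :=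
  ∃ (Q : C) (f : W ⟶ Q) (g : Q ⟶ X) (δ : X ⟶ W⟦(1 : ℤ)⟧),
    Triangle.mk f g δ ∈ distTriang C ∧ IsGhost S δ ∧ IsLeftApprox S f

/-- `Y` has a resolution by at most `m` objects of `S`. -/
def HasResolution : ℕ → C → Prop
  | 0, Y => IsZero Y
  | m + 1, Y => ∃ Y' : C, IsRelSyzygy S Y' Y ∧ HasResolution m Y'

variable {S}

lemma IsShiftAdditive.of_iso (hS : IsShiftAdditive S) {X Y : C} (e : X ≅ Y) (hX : S X) : S Y :=
  hS.retract Y X ⟨⟨e.inv, e.hom, e.inv_hom_id⟩⟩ hX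

lemma IsShiftAdditive.extension (hS : IsShiftAdditive S) {X Y Z : C} {f : X ⟶ Y} {g : Y ⟶ Z}
    {δ : Z ⟶ X⟦(1 : ℤ)⟧} (hT : Triangle.mk f g δ ∈ distTriang C) (h : δ = 0) (hX : S X)
    (hZ : S Z) : S Y := by
  obtain ⟨e, -, -⟩ := exists_iso_binaryBiproduct_of_distTriang _ hT h
  exact hS.of_iso e.symm (hS.biprod _ _ hX hZ)

section Exactness

variable {X Y Z P : C} {f : X ⟶ Y} {g : Y ⟶ Z} {δ : Z ⟶ X⟦(1 : ℤ)⟧}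

lemma rotate_distinguished (hT : Triangle.mk f g δ ∈ distTriang C) :
    Triangle.mk g δ (-f⟦(1 : ℤ)⟧') ∈ distTriang C :=
  rot_of_distTriang _ hT

lemma exists_desc_of_comp_eq_zero (hT : Triangle.mk f g δ ∈ distTriang C)
    (k : Z ⟶ P) (hk : g ≫ k = 0) :
    ∃ l : X⟦(1 : ℤ)⟧ ⟶ P, k = δ ≫ l :=
  Triangle.yoneda_exact₃ _ hT k hk

lemma exists_lift_of_comp_shift_eq_zero (hT : Triangle.mk f g δ ∈ distTriang C)
    (k : P ⟶ X⟦(1 : ℤ)⟧) (hk : k ≫ f⟦(1 : ℤ)⟧' = 0) :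
    ∃ l : P ⟶ Z, k = l ≫ δ :=
  Triangle.coyoneda_exact₁ _ hT k hk

lemma exists_lift_of_comp_eq_zero (hT : Triangle.mk f g δ ∈ distTriang C)
    (k : P ⟶ Z) (hk : k ≫ δ = 0) :
    ∃ l : P ⟶ Y, k = l ≫ g :=
  Triangle.coyoneda_exact₃ _ hT k hk

lemma exists_factor_of_comp_shift_eq_zero (hT : Triangle.mk f g δ ∈ distTriang C)
    (k : X ⟶ P) (hk : δ ≫ k⟦(1 : ℤ)⟧' = 0) :
    ∃ h : Y ⟶ P, f ≫ h = k := by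
  obtain ⟨h', hh'⟩ := exists_desc_of_comp_eq_zero (rotate_distinguished hT) _ hk
  obtain ⟨h, rfl⟩ := (shiftFunctor C (1 : ℤ)).map_surjective h'
  refine ⟨-h, (shiftFunctor C (1 : ℤ)).map_injective ?_⟩
  rw [hh', Functor.map_comp, Functor.map_neg]
  simp

end Exactness

/-- By the long exact sequence, `k` extends along `f` exactly when the connecting morphism followed
by `k⟦1⟧` is zero. -/
lemma isLeftApprox_iff {G Q Z : C} {f : G ⟶ Q} {g : Q ⟶ Z}
    {δ : Z ⟶ G⟦(1 : ℤ)⟧} (hT : Triangle.mk f g δ ∈ distTriang C) :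
    IsLeftApprox S f ↔ S Q ∧ ∀ ⦃P : C⦄, S P → ∀ k : G ⟶ P, δ ≫ k⟦(1 : ℤ)⟧' = 0 := by
  constructor
  · rintro ⟨hQ, h⟩
    refine ⟨hQ, fun P hP k => ?_⟩
    obtain ⟨l, rfl⟩ := h hP k
    have : δ ≫ f⟦(1 : ℤ)⟧' = 0 := comp_distTriang_mor_zero₃₁ _ hT
    rw [Functor.map_comp, reassoc_of% this, zero_comp]
  · rintro ⟨hQ, h⟩
    exact ⟨hQ, fun P hP k => exists_factor_of_comp_shift_eq_zero hT k (h hP k)⟩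

lemma distinguished_biprod (X Y : C) :
    Triangle.mk (biprod.inl : X ⟶ X ⊞ Y) biprod.snd (0 : Y ⟶ X⟦(1 : ℤ)⟧) ∈ distTriang C :=
  binaryBiproductTriangle_distinguished X Y

lemma IsStrongSyzygy.isRelSyzygy {W X : C} (h : IsStrongSyzygy S W X) : IsRelSyzygy S W X := by
  obtain ⟨Q, f, g, δ, hT, hδ, hf⟩ := h
  exact ⟨Q, hf.1, f, g, δ, hT, hδ⟩

/-- A ghost on `X` dies on the middle term `Q`, so it factors through the connecting morphism; the
left approximation property kills what remains. This is how `O 1` arises. -/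
lemma IsStrongSyzygy.ghost_eq_zero (hS : IsShiftAdditive S) {W X : C} (h : IsStrongSyzygy S W X)
    {P : C} (hP : S P) (f : X ⟶ P) (hf : IsGhost S f) : f = 0 := by
  obtain ⟨Q, a, b, δ, hT, hδ, ha⟩ := h
  obtain ⟨k, hk⟩ := exists_desc_of_comp_eq_zero hT f (hf ha.1 b)
  let e : P ≅ (P⟦(-1 : ℤ)⟧)⟦(1 : ℤ)⟧ := ((shiftEquiv C (1 : ℤ)).counitIso.app P).symm
  obtain ⟨l, hl⟩ := (shiftFunctor C (1 : ℤ)).map_surjective (k ≫ e.hom)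
  have h0 := ((isLeftApprox_iff hT).1 ha).2 (hS.shift P (-1) hP) l
  rw [← cancel_mono e.hom, zero_comp, hk, Category.assoc, ← hl, h0]

/-- The obstruction to extending `W ⟶ P` over the middle term is a ghost from `X` to `P⟦1⟧`, which
the hypothesis makes zero. -/
lemma IsRelSyzygy.isStrongSyzygy (hS : IsShiftAdditive S) {W X : C} (h : IsRelSyzygy S W X)
    (hX : ∀ ⦃P : C⦄, S P → ∀ f : X ⟶ P, IsGhost S f → f = 0) : IsStrongSyzygy S W X := by
  obtain ⟨Q, hQ, a, b, δ, hT, hδ⟩ := h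
  exact ⟨Q, a, b, δ, hT, hδ, (isLeftApprox_iff hT).2
    ⟨hQ, fun P hP k => hX (hS.shift P 1 hP) _ (hδ.comp_right _)⟩⟩

/-- A map `P ⟶ X ⟶ W⟦1⟧` is killed by everything coming from `W ⟶ P'`. After desuspension `hW`
applies, so the connecting morphism of the cone of `q` is a ghost. -/
lemma IsStrongSyzygy.of_leftApprox (hS : IsShiftAdditive S) {W Q : C} {q : W ⟶ Q}
    (hq : IsLeftApprox S q)
    (hW : ∀ ⦃P : C⦄, S P → ∀ f : P ⟶ W,
      (∀ ⦃P' : C⦄, S P' → ∀ g : W ⟶ P', f ≫ g = 0) → f = 0) :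
    ∃ X, IsStrongSyzygy S W X := by
  obtain ⟨X, g, δ, hT⟩ := distinguished_cocone_triangle q
  refine ⟨X, Q, q, g, δ, hT, fun P hP a => ?_, hq⟩
  let e : (P⟦(-1 : ℤ)⟧)⟦(1 : ℤ)⟧ ≅ P := (shiftEquiv C (1 : ℤ)).counitIso.app P
  obtain ⟨l, hl⟩ := (shiftFunctor C (1 : ℤ)).map_surjective (e.hom ≫ a ≫ δ)
  have hl0 : l = 0 := hW (hS.shift P (-1) hP) l fun P' hP' k => by
    apply (shiftFunctor C (1 : ℤ)).map_injective
    rw [Functor.map_comp, hl, Category.assoc, Category.assoc,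
      ((isLeftApprox_iff hT).1 hq).2 hP' k]
    simp
  rw [hl0, Functor.map_zero] at hl
  rw [← cancel_epi e.hom, ← hl, comp_zero]

lemma IsStrongSyzygy.coghost_eq_zero {W X : C} (h : IsStrongSyzygy S W X) (hS : IsShiftAdditive S)
    {P : C} (hP : S P) (f : P ⟶ W)
    (hf : ∀ ⦃P' : C⦄, S P' → ∀ g : W ⟶ P', f ≫ g = 0) : f = 0 := by
  obtain ⟨Q, a, b, δ, hT, hδ, ha⟩ := h
  have h1 : f⟦(1 : ℤ)⟧' ≫ a⟦(1 : ℤ)⟧' = 0 := by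
    rw [← Functor.map_comp, hf ha.1 a, Functor.map_zero]
  obtain ⟨k, hk⟩ := exists_lift_of_comp_shift_eq_zero hT _ h1
  apply (shiftFunctor C (1 : ℤ)).map_injective
  rw [hk, Functor.map_zero]
  exact hδ (hS.shift P 1 hP) k

/-! ### The two exchange steps, by octahedra -/

section Octahedra

variable [IsTriangulated C]

/-- Exchanging a syzygy at the right end of an extension for a cosyzygy of its middle term. -/
theorem IsGhostExt.ascend (hS : IsShiftAdditive S) {Y G X' X Z : C} (h : IsGhostExt S Y G X')
    (hX : IsRelSyzygy S X' X) (hG : IsStrongSyzygy S G Z) :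
    ∃ Y' E : C, IsGhostExt S Y' E X ∧ IsRelSyzygy S Y Y' ∧ IsStrongSyzygy S G E := by
  have hG' := hG
  obtain ⟨f, g, δ₁, hT₁, hδ₁⟩ := h
  obtain ⟨P, hP, a, b, δ₂, hT₂, hδ₂⟩ := hX
  obtain ⟨Q, q, r, δ₃, hT₃, hδ₃, hq⟩ := hG
  obtain ⟨Y', v, w, hT₄⟩ := distinguished_cocone_triangle (f ≫ q)
  let o := someOctahedron rfl hT₁ hT₃ hT₄
  -- The octahedron makes `w ≫ f⟦1⟧` factor through the ghost `δ₃`, so `k ≫ w` lifts along `δ₁`,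
  -- where it is zero.
  have hw : IsGhost S w := fun P₀ hP₀ k => by
    have h1 : (k ≫ w) ≫ f⟦(1 : ℤ)⟧' = 0 := by
      rw [Category.assoc, o.comm₄, ← Category.assoc]
      exact hδ₃ hP₀ _
    obtain ⟨l, hl⟩ := exists_lift_of_comp_shift_eq_zero hT₁ _ h1
    rw [hl]
    exact hδ₁ hP₀ l
  -- This is a ghost from the cosyzygy `Z` to an object of `S`. Since it is zero, the composite `Z ⟶
  -- X'⟦1⟧ ⟶ P⟦1⟧` has fibre `P ⊞ Z`, and the octahedron `o₂` gives the extension `Y' ⟶ P ⊞ Z ⟶ X`.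
  have hzero : (δ₃ ≫ g⟦(1 : ℤ)⟧') ≫ (-a⟦(1 : ℤ)⟧') = 0 :=
    hG'.ghost_eq_zero hS (hS.shift P 1 hP) _ ((hδ₃.comp_right _).comp_right _)
  let o₂ := someOctahedron' hzero (rotate_distinguished o.mem)
    (rotate_distinguished (rotate_distinguished hT₂))
    (rotate_distinguished (distinguished_biprod P Z))
  -- Adding `P` to the cosyzygy `Z` is harmless: the new middle term `F` is an extension of `Q` by
  -- `P` with zero connecting morphism.
  obtain ⟨F, c, d, hT₅⟩ := distinguished_cocone_triangle₂ ((biprod.snd : P ⊞ Z ⟶ Z) ≫ δ₃)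
  let o₃ := someOctahedron' rfl (distinguished_biprod P Z) (rotate_distinguished hT₃)
    (rotate_distinguished hT₅)
  have hF : S F := hS.extension o₃.mem comp_zero hP hq.1
  exact ⟨Y', P ⊞ Z, ⟨_, _, _, o₂.mem, hδ₂.comp_right _⟩, ⟨Q, hq.1, f ≫ q, v, w, hT₄, hw⟩,
    F, c, d, _, hT₅, hδ₃.comp_left _, (isLeftApprox_iff hT₅).2 ⟨hF, fun P₀ hP₀ k => by
      rw [Category.assoc, ((isLeftApprox_iff hT₃).1 hq).2 hP₀, comp_zero]⟩⟩

/-- Exchanging an extension for an extension of the syzygies of its terms. -/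
theorem IsGhostExt.descend (hS : IsShiftAdditive S) {Y' Y G X' X : C} (h : IsGhostExt S Y G X)
    (hX : IsRelSyzygy S X' X) (hY : IsRelSyzygy S Y' Y) :
    ∃ G' : C, IsGhostExt S Y' G' X' ∧ IsRelSyzygy S G' G := by
  obtain ⟨f, g, δ₁, hT₁, hδ₁⟩ := h
  obtain ⟨P, hP, a, b, δ₂, hT₂, hδ₂⟩ := hX
  obtain ⟨Q, hQ, q, r, δ₃, hT₃, hδ₃⟩ := hY
  -- The ghost `δ₁` kills `b`, so the fibre of `P ⟶ X ⟶ Y⟦1⟧` is `Y ⊞ P`, and comparing fibres gives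
  -- a triangle `X' ⟶ Y ⊞ P ⟶ G`.
  let o₁ := someOctahedron' (hδ₁ hP b) hT₂ (rotate_distinguished hT₁)
    (rotate_distinguished (distinguished_biprod Y P))
  -- `F` resolves `Y ⊞ P` by `Q` and `P`, as in the horseshoe lemma; the fibre of `F ⟶ Y ⊞ P ⟶ G` is
  -- the required syzygy of `G`.
  obtain ⟨F, c, d, hT₄⟩ := distinguished_cocone_triangle₂ ((biprod.fst : Y ⊞ P ⟶ Y) ≫ δ₃)
  have hfst : Triangle.mk (biprod.inr : P ⟶ Y ⊞ P) biprod.fst (0 : Y ⟶ P⟦(1 : ℤ)⟧) ∈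
      distTriang C :=
    isomorphic_distinguished _ (distinguished_biprod P Y) _
      (Triangle.isoMk _ _ (Iso.refl _) (biprod.braiding _ _) (Iso.refl _)
        (show biprod.inr ≫ (biprod.braiding Y P).hom = 𝟙 P ≫ biprod.inl by ext <;> simp)
        (show biprod.fst ≫ 𝟙 Y = (biprod.braiding Y P).hom ≫ biprod.snd by simp)
        (zero_comp.trans comp_zero.symm))
  let o₂ := someOctahedron' rfl hfst (rotate_distinguished hT₃) (rotate_distinguished hT₄)
  have hF : S F := hS.extension o₂.mem comp_zero hP hQ
  obtain ⟨G', u, w, hT₅⟩ := distinguished_cocone_triangle₁ (d ≫ o₁.m₃)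
  let o₃ := someOctahedron' rfl hT₄ o₁.mem hT₅
  refine ⟨G', ⟨_, _, _, o₃.mem, (hδ₃.comp_left _).comp_left _⟩, F, hF, u, _, w, hT₅,
    fun P₀ hP₀ k => ?_⟩
  obtain ⟨l, rfl⟩ := exists_lift_of_comp_eq_zero o₁.mem k (hδ₂.comp_left g hP₀ k)
  rw [Category.assoc, ← o₃.comm₂, ← Category.assoc, hδ₃.comp_left _ hP₀ l, zero_comp]

end Octahedra

/-! ### Vanishing conditions and the induction on the order of the syzygy -/

variable (S)

/-- `W` is an `n`th syzygy of `X` relative to `S`. -/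
def IsNthRelSyzygy : ℕ → C → C → Prop
  | 0, X, W => Nonempty (W ≅ X)
  | n + 1, X, W => ∃ V : C, IsNthRelSyzygy n X V ∧ IsRelSyzygy S W V

/-- Two sequences of vanishing conditions which are controlled by `S`: the conditions `O` shift
along syzygies, the conditions `T` along cosyzygies. -/
structure IsVanishingPair (O T : ℕ → C → Prop) : Prop where
  iso : ∀ (j : ℕ) {X Y : C}, (X ≅ Y) → T (j + 1) X → T (j + 1) Y
  one_left : ∀ G : C, O 1 G ↔ ∀ ⦃P : C⦄, S P → ∀ f : G ⟶ P, IsGhost S f → f = 0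
  one_right : ∀ W : C, T 1 W ↔ ∀ ⦃P : C⦄, S P → ∀ f : P ⟶ W,
    (∀ ⦃P' : C⦄, S P' → ∀ g : W ⟶ P', f ≫ g = 0) → f = 0
  succ_left : ∀ (j : ℕ) {W G : C}, IsRelSyzygy S W G → (O (j + 1) W ↔ O (j + 2) G)
  succ_right : ∀ (j : ℕ) {W Z : C}, IsStrongSyzygy S W Z → (T (j + 1) Z ↔ T (j + 2) W)
  exists_leftApprox : ∀ W : C, ∃ (Q : C) (q : W ⟶ Q), IsLeftApprox S q

variable {S}

variable {O T : ℕ → C → Prop}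

lemma IsGhostExt.of_iso_right {Y G X X' : C} (h : IsGhostExt S Y G X) (e : X ≅ X') :
    IsGhostExt S Y G X' := by
  obtain ⟨f, g, δ, hT, hδ⟩ := h
  refine ⟨f, g ≫ e.hom, e.inv ≫ δ, isomorphic_distinguished _ hT _
    (Triangle.isoMk _ _ (Iso.refl _) (Iso.refl _) e.symm ?_ ?_ ?_), hδ.comp_left _⟩
  · exact (Category.comp_id _).trans (Category.id_comp _).symm
  · change (g ≫ e.hom) ≫ e.inv = 𝟙 _ ≫ g
    simp
  · change (e.inv ≫ δ) ≫ (𝟙 Y)⟦(1 : ℤ)⟧' = e.inv ≫ δ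
    simp

variable [IsTriangulated C]

/-- `T 1` makes the cone of a left approximation of `G` a strong cosyzygy, so `ascend` applies. Here
`m` counts the steps already made and `k` those still to be made. -/
lemma IsVanishingPair.exists_ghostExt (hS : IsShiftAdditive S) (H : IsVanishingPair S O T) (k : ℕ) :
    ∀ (m : ℕ) {X W Y G : C}, IsNthRelSyzygy S k X W → IsGhostExt S Y G W →
      HasResolution S m Y → UpTo O m G → UpTo T k G →
      ∃ Y' G' : C, IsGhostExt S Y' G' X ∧ HasResolution S (m + k) Y' ∧ UpTo O (m + k) G' := by
  induction k with
  | zero =>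
    rintro m X W Y G ⟨e⟩ h hY hO -
    exact ⟨Y, G, h.of_iso_right e, hY, hO⟩
  | succ k ih =>
    rintro m X W Y G ⟨V, hV, hW⟩ h hY hO hT
    obtain ⟨Q, q, hq⟩ := H.exists_leftApprox G
    obtain ⟨Z, hZ⟩ := IsStrongSyzygy.of_leftApprox hS hq
      ((H.one_right G).1 (hT 1 le_rfl (by lia)))
    obtain ⟨Y', E, hE, hY', hGE⟩ := h.ascend hS hW hZ
    rw [show m + (k + 1) = m + 1 + k by lia]
    exact ih (m + 1) hV hE ⟨Y, hY', hY⟩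
      ((upTo_succ_iff fun j => H.succ_left j hGE.isRelSyzygy).2
        ⟨(H.one_left E).2 fun P hP f hf => hGE.ghost_eq_zero hS hP f hf, hO⟩)
      ((upTo_succ_iff fun j => H.succ_right j hGE).1 hT).2

/-- The reverse passage by `descend`: `O 1` upgrades the syzygy of the middle term to a strong one,
which gives back `T 1`. -/
lemma IsVanishingPair.exists_syzygy_ghostExt (hS : IsShiftAdditive S) (H : IsVanishingPair S O T)
    (k : ℕ) :
    ∀ (m : ℕ) {X W Y G : C}, IsNthRelSyzygy S k X W → IsGhostExt S Y G X →
      HasResolution S (m + k) Y → UpTo O (m + k) G →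
      ∃ Y' G' : C, IsGhostExt S Y' G' W ∧ HasResolution S m Y' ∧ UpTo O m G' ∧ UpTo T k G' := by
  induction k with
  | zero =>
    rintro m X W Y G ⟨e⟩ h hY hO
    exact ⟨Y, G, h.of_iso_right e.symm, hY, hO, upTo_zero _ _⟩
  | succ k ih =>
    rintro m X W Y G ⟨V, hV, hW⟩ h hY hO
    rw [show m + (k + 1) = m + 1 + k by lia] at hY hO
    obtain ⟨Y₁, G₁, h₁, ⟨Y', hY', hres⟩, hO₁, hT₁⟩ := ih (m + 1) hV h hY hO
    obtain ⟨G', hG', hGG'⟩ := h₁.descend hS hW hY'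
    have hstrong := hGG'.isStrongSyzygy hS ((H.one_left G₁).1 (hO₁ 1 le_rfl (by lia)))
    exact ⟨Y', G', hG', hres, ((upTo_succ_iff fun j => H.succ_left j hGG').1 hO₁).2,
      (upTo_succ_iff fun j => H.succ_right j hstrong).2
        ⟨(H.one_right G').2 fun P hP f hf => hstrong.coghost_eq_zero hS hP f hf, hT₁⟩⟩

theorem IsVanishingPair.upTo_nthSyzygy_iff (hS : IsShiftAdditive S) (H : IsVanishingPair S O T)
    {n : ℕ} {X W : C} (hW : IsNthRelSyzygy S n X W) :
    UpTo T n W ↔ ∃ Y G : C, IsGhostExt S Y G X ∧ UpTo O n G ∧ HasResolution S n Y := by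
  constructor
  · intro h
    -- The start is the triangle `0 ⟶ W ⟶ W`, with a resolution of no terms and no `O` condition.
    obtain ⟨Y, G, h1, h2, h3⟩ := H.exists_ghostExt hS n 0 (Y := (0 : C)) (G := W) hW
      ⟨0, 𝟙 W, 0, contractible_distinguished₁ W, fun P _ g => comp_zero⟩ (isZero_zero C)
      (upTo_zero _ _) h
    rw [Nat.zero_add] at h2 h3
    exact ⟨Y, G, h1, h3, h2⟩
  · rintro ⟨Y, G, h1, h2, h3⟩
    obtain ⟨Y', G', ⟨f, g, δ, hT, -⟩, hY', -, hG'⟩ := H.exists_syzygy_ghostExt hS n 0 hW h1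
      (by rwa [Nat.zero_add]) (by rwa [Nat.zero_add])
    have : IsIso g := (Triangle.isZero₁_iff_isIso₂ _ hT).1 hY'
    intro j hj hj'
    obtain ⟨j, rfl⟩ := Nat.exists_eq_add_of_le' hj
    exact H.iso j (asIso g) (hG' _ hj hj')

end RelativeSyzygy

/-! ### Vanishing of Ext and dimension shifting for cokernels -/

namespace StableComplex

section ExtVanishing

variable {A : Type u} [Ring A]

/-- The vanishing of `Extʲ_A(M, E)`. -/
abbrev ExtVanish (E : Type u) [AddCommGroup E] [Module A E] (j : ℕ) (M : Type u) [AddCommGroup M]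
    [Module A M] : Prop :=
  Subsingleton (Abelian.Ext (ModuleCat.of A M) (ModuleCat.of A E) j)

variable {E K M N P : Type u} [AddCommGroup E] [Module A E] [AddCommGroup K] [Module A K]
  [AddCommGroup M] [Module A M] [AddCommGroup N] [Module A N] [AddCommGroup P] [Module A P]

lemma extVanish_of_projective [Module.Projective A P] (j : ℕ) :
    ExtVanish (A := A) E (j + 1) P := by
  have : Projective (ModuleCat.of A P) := (IsProjective.iff_projective P).1 inferInstance
  exact Abelian.Ext.subsingleton_of_projective _ _ _

/-- Positive Ext is additive and vanishes on projectives, so it only sees `M` modulo maps through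
projectives. With `P` zero this covers ordinary retracts. -/
lemma ExtVanish.of_factor {j : ℕ} (h : ExtVanish (A := A) E (j + 1) N) [Module.Projective A P]
    (i : M →ₗ[A] N) (r : N →ₗ[A] M) (t : M →ₗ[A] P) (s : P →ₗ[A] M)
    (hid : r ∘ₗ i + s ∘ₗ t = LinearMap.id) : ExtVanish (A := A) E (j + 1) M := by
  have hP := extVanish_of_projective (A := A) (E := E) (P := P) j
  refine subsingleton_of_forall_eq 0 fun x => ?_
  have h1 : 𝟙 (ModuleCat.of A M) = ModuleCat.ofHom i ≫ ModuleCat.ofHom r +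
      ModuleCat.ofHom t ≫ ModuleCat.ofHom s := by
    ext m
    exact (LinearMap.congr_fun hid m).symm
  rw [← Abelian.Ext.mk₀_id_comp x, h1, Abelian.Ext.mk₀_add, Abelian.Ext.add_comp,
    ← Abelian.Ext.mk₀_comp_mk₀_assoc, ← Abelian.Ext.mk₀_comp_mk₀_assoc,
    Subsingleton.elim ((Abelian.Ext.mk₀ (ModuleCat.ofHom r)).comp x _) 0,
    Subsingleton.elim ((Abelian.Ext.mk₀ (ModuleCat.ofHom s)).comp x _) 0]
  simp

lemma extVanish_congr (e : M ≃ₗ[A] N) (j : ℕ) :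
    ExtVanish (A := A) E (j + 1) M ↔ ExtVanish (A := A) E (j + 1) N :=
  ⟨fun h => h.of_factor (P := PUnit.{u + 1}) e.symm.toLinearMap e.toLinearMap 0 0
      (by ext; simp),
    fun h => h.of_factor (P := PUnit.{u + 1}) e.toLinearMap e.symm.toLinearMap 0 0
      (by ext; simp)⟩

/-- The short exact sequence of modules given by linear maps. -/
lemma shortExact_of_linearMap {f : K →ₗ[A] M} {g : M →ₗ[A] P} (hf : Function.Injective f)
    (hg : Function.Surjective g) (hfg : Function.Exact f g) :
    (ShortComplex.mk (ModuleCat.ofHom f) (ModuleCat.ofHom g)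
      (by ext x; exact hfg.apply_apply_eq_zero x)).ShortExact where
  exact := (ShortComplex.moduleCat_exact_iff _).2 fun x hx => (hfg x).1 hx
  mono_f := (ModuleCat.mono_iff_injective _).2 hf
  epi_g := (ModuleCat.epi_iff_surjective _).2 hg

lemma extVanish_iff_of_projective_quotient {f : K →ₗ[A] M} {g : M →ₗ[A] P}
    (hf : Function.Injective f) (hg : Function.Surjective g) (hfg : Function.Exact f g)
    [Module.Projective A P] (j : ℕ) :
    ExtVanish (A := A) E (j + 1) M ↔ ExtVanish (A := A) E (j + 1) K := by
  obtain ⟨s, hs⟩ := Module.projective_lifting_property g LinearMap.id hg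
  obtain ⟨r, hr⟩ : ∃ r : M →ₗ[A] K, ∀ m, f (r m) = m - s (g m) := by
    have : ∀ m, m - s (g m) ∈ LinearMap.range f := fun m => (hfg _).1 (by
      rw [map_sub, sub_eq_zero]
      exact (LinearMap.congr_fun hs (g m)).symm)
    refine ⟨(LinearEquiv.ofInjective f hf).symm.toLinearMap ∘ₗ
      (LinearMap.id - s ∘ₗ g).codRestrict (LinearMap.range f) this, fun m => ?_⟩
    exact congrArg Subtype.val ((LinearEquiv.ofInjective f hf).apply_symm_apply _)
  refine ⟨fun h => h.of_factor (P := PUnit.{u + 1}) f r 0 0 ?_, fun h => h.of_factor r f g s ?_⟩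
  · ext k
    apply hf
    simp [hr, hfg.apply_apply_eq_zero]
  · ext m
    simp [hr]

lemma extVanish_succ_iff {f : K →ₗ[A] N} {g : N →ₗ[A] M}
    (hf : Function.Injective f) (hg : Function.Surjective g) (hfg : Function.Exact f g)
    [Module.Projective A N] (j : ℕ) :
    ExtVanish (A := A) E (j + 1) K ↔ ExtVanish (A := A) E (j + 2) M := by
  have hS := shortExact_of_linearMap hf hg hfg
  have h1 := extVanish_of_projective (A := A) (E := E) (P := N) j
  have h2 := extVanish_of_projective (A := A) (E := E) (P := N) (j + 1)
  constructor
  · intro h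
    refine subsingleton_of_forall_eq 0 fun x => ?_
    obtain ⟨y, hy⟩ := Abelian.Ext.contravariant_sequence_exact₃ hS (ModuleCat.of A E) x
      (h2.elim _ _) (n₀ := j + 1) (by lia)
    rw [← hy, h.elim y 0, Abelian.Ext.comp_zero]
  · intro h
    refine subsingleton_of_forall_eq 0 fun x => ?_
    obtain ⟨y, hy⟩ := Abelian.Ext.contravariant_sequence_exact₁ hS (ModuleCat.of A E) x
      (n₁ := j + 2) (by lia) (h.elim _ _)
    rw [← hy, h1.elim y 0, Abelian.Ext.comp_zero]

lemma extVanish_one_iff {f : K →ₗ[A] N} {g : N →ₗ[A] M}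
    (hf : Function.Injective f) (hg : Function.Surjective g) (hfg : Function.Exact f g)
    [Module.Projective A N] :
    ExtVanish (A := A) E 1 M ↔ ∀ φ : K →ₗ[A] E, ∃ ψ : N →ₗ[A] E, ψ ∘ₗ f = φ := by
  have hS := shortExact_of_linearMap hf hg hfg
  have h2 := extVanish_of_projective (A := A) (E := E) (P := N) 0
  constructor
  · intro h φ
    obtain ⟨y, hy⟩ := Abelian.Ext.contravariant_sequence_exact₁ hS (ModuleCat.of A E)
      (Abelian.Ext.mk₀ (ModuleCat.ofHom φ)) (n₁ := 1) (by lia) (h.elim _ _)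
    obtain ⟨ψ, rfl⟩ := (Abelian.Ext.mk₀_bijective _ _).2 y
    rw [Abelian.Ext.mk₀_comp_mk₀] at hy
    have := (Abelian.Ext.mk₀_bijective _ _).1 hy
    exact ⟨ψ.hom, congrArg ModuleCat.Hom.hom this⟩
  · intro h
    refine subsingleton_of_forall_eq 0 fun x => ?_
    obtain ⟨y, hy⟩ := Abelian.Ext.contravariant_sequence_exact₃ hS (ModuleCat.of A E) x
      (h2.elim _ _) (n₀ := 0) (by lia)
    obtain ⟨φ, rfl⟩ := (Abelian.Ext.mk₀_bijective _ _).2 y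
    obtain ⟨ψ, hψ⟩ := h φ.hom
    have : φ = ModuleCat.ofHom f ≫ ModuleCat.ofHom ψ := by
      ext x
      exact (LinearMap.congr_fun hψ x).symm
    rw [← hy, this, ← Abelian.Ext.mk₀_comp_mk₀]
    exact hS.extClass_comp_assoc _

lemma exact_liftQ_ker_mkQ_range (b : M →ₗ[A] N) :
    Function.Exact ((LinearMap.ker b).liftQ b le_rfl) (LinearMap.range b).mkQ := by
  rw [LinearMap.exact_iff, Submodule.ker_mkQ, Submodule.range_liftQ]

lemma injective_liftQ_ker (b : M →ₗ[A] N) {L : Submodule A M} (hL : L = LinearMap.ker b) :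
    Function.Injective (L.liftQ b hL.le) := by
  rw [← LinearMap.ker_eq_bot]
  exact Submodule.ker_liftQ_eq_bot _ _ _ hL.ge

/-- `Ext¹_A(coker b, E) = 0` means that the functionals vanishing on `ker b` extend along `b`. -/
lemma extVanish_one_coker_iff [Module.Projective A N] (b : M →ₗ[A] N) :
    ExtVanish (A := A) E 1 (N ⧸ LinearMap.range b) ↔
      ∀ φ : M →ₗ[A] E, (∀ m, b m = 0 → φ m = 0) → ∃ ψ : N →ₗ[A] E, ∀ m, ψ (b m) = φ m := by
  rw [extVanish_one_iff (injective_liftQ_ker b rfl) (Submodule.mkQ_surjective _)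
    (exact_liftQ_ker_mkQ_range b)]
  constructor
  · intro h φ hφ
    obtain ⟨ψ, hψ⟩ := h ((LinearMap.ker b).liftQ φ hφ)
    exact ⟨ψ, fun m => LinearMap.congr_fun hψ (Submodule.Quotient.mk m)⟩
  · intro h φ
    obtain ⟨ψ, hψ⟩ := h (φ ∘ₗ (LinearMap.ker b).mkQ) fun m hm => by
      rw [LinearMap.comp_apply, Submodule.mkQ_apply, (Submodule.Quotient.mk_eq_zero _).2 hm, map_zero]
    refine ⟨ψ, ?_⟩
    ext m
    exact hψ m

/-- Dimension shifting for the cokernel of a map whose image is embedded in another module with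
projective cokernel. -/
lemma extVanish_coker_succ_iff [Module.Projective A N] [Module.Projective A P] {L : Type u}
    [AddCommGroup L] [Module A L] (b : M →ₗ[A] N) (v : M →ₗ[A] L) (w : L →ₗ[A] P)
    (hv : LinearMap.ker v = LinearMap.ker b) (hw : Function.Surjective w)
    (hvw : Function.Exact v w) (j : ℕ) :
    ExtVanish (A := A) E (j + 1) L ↔ ExtVanish (A := A) E (j + 2) (N ⧸ LinearMap.range b) := by
  rw [← extVanish_succ_iff (injective_liftQ_ker b rfl) (Submodule.mkQ_surjective _)
    (exact_liftQ_ker_mkQ_range b)]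
  refine extVanish_iff_of_projective_quotient (injective_liftQ_ker v hv.symm) hw ?_ j
  rw [LinearMap.exact_iff, Submodule.range_liftQ, LinearMap.exact_iff.1 hvw]

/-- Dimension shifting for the cokernel of a map `x, y ↦ (a x, p x + c y)`. -/
lemma extVanish_coker_cone_iff {P₀ P₁ G₀ G₁ G₂ M₀ M₁ : Type u}
    [AddCommGroup P₀] [Module A P₀] [AddCommGroup P₁] [Module A P₁]
    [AddCommGroup G₀] [Module A G₀] [AddCommGroup G₁] [Module A G₁]
    [AddCommGroup G₂] [Module A G₂] [AddCommGroup M₀] [Module A M₀] [AddCommGroup M₁] [Module A M₁]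
    (a : P₀ →ₗ[A] P₁) (p : P₀ →ₗ[A] G₁) (c : G₀ →ₗ[A] G₁) (b : G₁ →ₗ[A] G₂)
    [Module.Projective A G₂] [Module.Projective A (P₁ ⧸ LinearMap.range a)]
    (hb : ∀ g, b g = 0 ↔ ∃ x y, a x = 0 ∧ g = p x + c y)
    (D : M₀ →ₗ[A] M₁) (e : M₁ ≃ₗ[A] P₁ × G₁)
    (hD : ∀ m, m ∈ LinearMap.range D ↔ ∃ x y, e m = (a x, p x + c y)) (j : ℕ) :
    ExtVanish (A := A) E (j + 1) (M₁ ⧸ LinearMap.range D) ↔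
      ExtVanish (A := A) E (j + 2) (G₂ ⧸ LinearMap.range b) := by
  -- By `hb` and `hD`, `v` has the same kernel as `b`, so the image of `b`, a first syzygy of `coker
  -- b`, sits in `coker D` with projective quotient `coker a`.
  let v : G₁ →ₗ[A] M₁ ⧸ LinearMap.range D :=
    (LinearMap.range D).mkQ ∘ₗ e.symm.toLinearMap ∘ₗ LinearMap.inr A P₁ G₁
  let w : (M₁ ⧸ LinearMap.range D) →ₗ[A] P₁ ⧸ LinearMap.range a :=
    (LinearMap.range D).liftQ ((LinearMap.range a).mkQ ∘ₗ LinearMap.fst A P₁ G₁ ∘ₗ e.toLinearMap)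
      fun m hm => by
        obtain ⟨x, y, h⟩ := (hD m).1 hm
        simp [h]
  refine extVanish_coker_succ_iff b v w ?_ ?_ ?_ j
  · ext g
    rw [LinearMap.mem_ker, LinearMap.mem_ker, hb]
    change Submodule.Quotient.mk _ = _ ↔ _
    rw [Submodule.Quotient.mk_eq_zero, hD]
    simp [Prod.ext_iff, eq_comm]
  · intro z
    obtain ⟨z, rfl⟩ := Submodule.mkQ_surjective _ z
    exact ⟨Submodule.Quotient.mk (e.symm (z, 0)), by simp [w]⟩
  · intro z
    obtain ⟨m, rfl⟩ := Submodule.mkQ_surjective _ z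
    constructor
    · intro h
      replace h : (LinearMap.range a).mkQ (e m).1 = 0 := h
      rw [Submodule.mkQ_apply, Submodule.Quotient.mk_eq_zero] at h
      obtain ⟨x, hx⟩ := h
      refine ⟨(e m).2 - p x, ?_⟩
      rw [← sub_eq_zero]
      change Submodule.Quotient.mk (_ - m) = _
      rw [Submodule.Quotient.mk_eq_zero, hD]
      refine ⟨-x, 0, ?_⟩
      rw [map_sub]
      simp [Prod.ext_iff, hx]
    · rintro ⟨g, hg⟩
      rw [← hg]
      simp [v, w]

end ExtVanishing

end StableComplex

/-! ### Complexes of projectives in terms of elements; split complexes -/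

namespace StableComplex

section Basic

variable {A : Type u} [Ring A]

/-- The linear map underlying a morphism of `proj A`. -/
def lin {M N : FGProj A} (f : M ⟶ N) : M.obj →ₗ[A] N.obj := f.hom.hom

/-- The morphism of `proj A` given by a linear map. -/
def ofLin {M N : FGProj A} (f : M.obj →ₗ[A] N.obj) : M ⟶ N :=
  ObjectProperty.homMk (ModuleCat.ofHom f)

@[simp] lemma lin_ofLin {M N : FGProj A} (f : M.obj →ₗ[A] N.obj) : lin (ofLin f) = f := rfl

lemma lin_injective {M N : FGProj A} {f g : M ⟶ N} (h : lin f = lin g) : f = g :=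
  ObjectProperty.hom_ext _ (ModuleCat.hom_ext h)

lemma hom_ext_apply {M N : FGProj A} {f g : M ⟶ N} (h : ∀ x, lin f x = lin g x) : f = g :=
  lin_injective (LinearMap.ext h)

@[simp] lemma lin_id_apply {M : FGProj A} (x : M.obj) : lin (𝟙 M) x = x := rfl

@[simp] lemma lin_comp_apply {M N L : FGProj A} (f : M ⟶ N) (g : N ⟶ L) (x : M.obj) :
    lin (f ≫ g) x = lin g (lin f x) := rfl

@[simp] lemma lin_zero {M N : FGProj A} : lin (0 : M ⟶ N) = 0 := rfl

@[simp] lemma lin_add_apply {M N : FGProj A} (f g : M ⟶ N) (x : M.obj) :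
    lin (f + g) x = lin f x + lin g x := rfl

@[simp] lemma lin_sub_apply {M N : FGProj A} (f g : M ⟶ N) (x : M.obj) :
    lin (f - g) x = lin f x - lin g x := rfl

instance (M : FGProj A) : Module.Finite A M.obj := M.property.1
instance (M : FGProj A) : Module.Projective A M.obj := M.property.2

/-- A finitely generated projective module as an object of `proj A`. -/
def fgProj (M : Type u) [AddCommGroup M] [Module A M] [Module.Finite A M] [Module.Projective A M] :
    FGProj A :=
  ⟨ModuleCat.of A M, ‹_›, ‹_›⟩

/-- The functor from complexes to the homotopy category. -/
abbrev toK (X : CochainComplex (FGProj A) ℤ) : KProj A :=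
  (HomotopyCategory.quotient (FGProj A) (ComplexShape.up ℤ)).obj X

/-- The homotopy class of a chain map. -/
abbrev toKMap {X Y : CochainComplex (FGProj A) ℤ} (f : X ⟶ Y) : toK X ⟶ toK Y :=
  (HomotopyCategory.quotient (FGProj A) (ComplexShape.up ℤ)).map f

lemma toKMap_surjective {X Y : CochainComplex (FGProj A) ℤ} (f : toK X ⟶ toK Y) :
    ∃ g : X ⟶ Y, toKMap g = f :=
  (HomotopyCategory.quotient (FGProj A) (ComplexShape.up ℤ)).map_surjective f

variable {X Y Z : CochainComplex (FGProj A) ℤ}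

lemma toKMap_comp (f : X ⟶ Y) (g : Y ⟶ Z) : toKMap (f ≫ g) = toKMap f ≫ toKMap g :=
  Functor.map_comp _ _ _

@[simp] lemma lin_d_lin_d (i j k : ℤ) (x : (X.X i).obj) :
    lin (X.d j k) (lin (X.d i j) x) = 0 := by
  rw [← lin_comp_apply, X.d_comp_d, lin_zero, LinearMap.zero_apply]

lemma lin_comm (f : X ⟶ Y) (i j : ℤ) (x : (X.X i).obj) :
    lin (Y.d i j) (lin (f.f i) x) = lin (f.f j) (lin (X.d i j) x) := by
  rw [← lin_comp_apply, f.comm, lin_comp_apply]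

lemma exists_homotopy_of_toKMap_eq {f g : X ⟶ Y} (h : toKMap f = toKMap g) :
    ∃ k : ∀ i j : ℤ, X.X i ⟶ Y.X j, ∀ i j l, i + 1 = j → l + 1 = i → ∀ x,
      lin (f.f i) x = lin (k j i) (lin (X.d i j) x) + lin (Y.d l i) (lin (k i l) x) +
        lin (g.f i) x := by
  let H := HomotopyCategory.homotopyOfEq _ _ h
  refine ⟨H.hom, fun i j l hij hli x => ?_⟩
  have := H.comm i
  rw [dNext_eq H.hom (show (ComplexShape.up ℤ).Rel i j from hij),
    prevD_eq H.hom (show (ComplexShape.up ℤ).Rel l i from hli)] at this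
  rw [this]
  rfl

lemma toKMap_eq_zero_iff (f : X ⟶ Y) :
    toKMap f = 0 ↔ ∃ k : ∀ i j : ℤ, X.X i ⟶ Y.X j, ∀ i j l, i + 1 = j → l + 1 = i → ∀ x,
      lin (f.f i) x = lin (k j i) (lin (X.d i j) x) + lin (Y.d l i) (lin (k i l) x) := by
  constructor
  · intro h
    obtain ⟨k, hk⟩ := exists_homotopy_of_toKMap_eq (f := f) (g := 0)
      (h.trans (Functor.map_zero _ _ _).symm)
    exact ⟨k, fun i j l hij hli x => (hk i j l hij hli x).trans (add_zero _)⟩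
  · rintro ⟨k, hk⟩
    rw [HomotopyCategory.quotient_map_eq_zero_iff]
    -- Only the components of degree `-1` enter the formula; a `Homotopy` must be zero elsewhere.
    let k' : ∀ i j : ℤ, X.X i ⟶ Y.X j := fun i j => if j + 1 = i then k i j else 0
    refine ⟨⟨k', fun i j hij => if_neg hij, fun i => ?_⟩⟩
    rw [dNext_eq k' (show (ComplexShape.up ℤ).Rel i (i + 1) from rfl),
      prevD_eq k' (show (ComplexShape.up ℤ).Rel (i - 1) i from sub_add_cancel i 1)]
    refine hom_ext_apply fun x => (hk i (i + 1) (i - 1) rfl (by lia) x).trans ?_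
    simp [k']

lemma isSplit_iff : IsSplit (toK X) ↔ ∃ s : ∀ i j : ℤ, X.X i ⟶ X.X j, ∀ i j, i + 1 = j → ∀ x,
    lin (X.d i j) (lin (s j i) (lin (X.d i j) x)) = lin (X.d i j) x := by
  constructor
  · intro h
    obtain ⟨s, hs⟩ : ∃ s : ∀ i : ℤ, X.X (i + 1) ⟶ X.X i,
      ∀ i : ℤ, X.d i (i + 1) ≫ s i ≫ X.d i (i + 1) = X.d i (i + 1) := h
    refine ⟨fun i j => if h : j + 1 = i then eqToHom (by subst h; rfl) ≫ s j else 0, ?_⟩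
    rintro i _ rfl x
    have := congrArg (fun f => lin f x) (hs i)
    simpa using this
  · rintro ⟨s, hs⟩
    exact ⟨fun i => s (i + 1) i, fun i => hom_ext_apply fun x => hs i (i + 1) rfl x⟩

/-- The complex with zero differential. -/
def zeroCpx (F : ℤ → FGProj A) : CochainComplex (FGProj A) ℤ where
  X := F
  d _ _ := 0

/-- A chain map out of a complex with zero differential. -/
def fromZeroCpx (F : ℤ → FGProj A) (φ : ∀ i, (F i).obj →ₗ[A] (X.X i).obj)
    (h : ∀ i j x, lin (X.d i j) (φ i x) = 0) : zeroCpx F ⟶ X where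
  f i := ofLin (φ i)
  comm' i j _ := hom_ext_apply fun x => (h i j x).trans (map_zero (φ j)).symm

/-- A chain map into a complex with zero differential. -/
def toZeroCpx (F : ℤ → FGProj A) (φ : ∀ i, (X.X i).obj →ₗ[A] (F i).obj)
    (h : ∀ i j x, φ j (lin (X.d i j) x) = 0) : X ⟶ zeroCpx F where
  f i := ofLin (φ i)
  comm' i j _ := hom_ext_apply fun x => (h i j x).symm

@[simp] lemma zeroCpx_d (F : ℤ → FGProj A) (i j : ℤ) : (zeroCpx F).d i j = 0 := rfl

lemma isSplit_zeroCpx (F : ℤ → FGProj A) : IsSplit (toK (zeroCpx F)) :=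
  isSplit_iff.2 ⟨fun _ _ => 0, fun _ _ _ _ => rfl⟩

lemma isSplit_of_retract {X Y : KProj A} (h : Nonempty (Retract X Y)) (hY : IsSplit Y) :
    IsSplit X := by
  obtain ⟨X, rfl⟩ := HomotopyCategory.quotient_obj_surjective X
  obtain ⟨Y, rfl⟩ := HomotopyCategory.quotient_obj_surjective Y
  obtain ⟨⟨i, r, hir⟩⟩ := h
  obtain ⟨i, rfl⟩ := toKMap_surjective i
  obtain ⟨r, rfl⟩ := toKMap_surjective r
  rw [← toKMap_comp] at hir
  obtain ⟨k, hk⟩ := exists_homotopy_of_toKMap_eq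
    (hir.trans (CategoryTheory.Functor.map_id (HomotopyCategory.quotient (FGProj A) (ComplexShape.up ℤ)) X).symm)
  obtain ⟨s, hs⟩ := isSplit_iff.1 hY
  -- Transporting `s` along the retract splits `d` up to the term `d k d` from the homotopy `k`
  -- between `i ≫ r` and the identity; subtracting `k` removes it.
  refine isSplit_iff.2 ⟨fun a b => i.f a ≫ s a b ≫ r.f b - k a b, fun a b hab x => ?_⟩
  have h1 := hk b (b + 1) a rfl hab (lin (X.d a b) x)
  have h2 := congrArg (lin (r.f b)) (hs a b hab (lin (i.f a) x))
  simp only [HomologicalComplex.comp_f, HomologicalComplex.id_f, lin_comp_apply, lin_id_apply,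
    lin_d_lin_d, map_zero, zero_add, lin_comm, lin_sub_apply, map_sub] at h1 h2 ⊢
  rw [h2, h1]
  abel

/-- A chain map which sends cycles to boundaries. -/
def CohZero (f : X ⟶ Y) : Prop :=
  ∀ i l : ℤ, l + 1 = i → ∀ x, (∀ j, lin (X.d i j) x = 0) → ∃ y, lin (Y.d l i) y = lin (f.f i) x

lemma CohZero.comp_left {g : Y ⟶ Z} (hg : CohZero g) (f : X ⟶ Y) : CohZero (f ≫ g) :=
  fun i l hl x hx => hg i l hl (lin (f.f i) x) fun j => by rw [lin_comm, hx, map_zero]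

/-- In a split complex `1 - s d` maps each term to cycles, which `f` sends to boundaries;
projectivity of the terms lifts this to `h` with `d h = f (1 - s d)`. -/
lemma CohZero.toKMap_eq_zero {f : X ⟶ Y} (hf : CohZero f) (hX : IsSplit (toK X)) :
    toKMap f = 0 := by
  obtain ⟨s, hs⟩ := isSplit_iff.1 hX
  have h1 : ∀ i l, ∃ h : X.X i ⟶ Y.X l, l + 1 = i → ∀ x, lin (Y.d l i) (lin h x) =
      lin (f.f i) (x - lin (s (i + 1) i) (lin (X.d i (i + 1)) x)) := by
    intro i l
    by_cases hl : l + 1 = i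
    · let e : (X.X i).obj →ₗ[A] (X.X i).obj :=
        LinearMap.id - lin (s (i + 1) i) ∘ₗ lin (X.d i (i + 1))
      have he : ∀ x, lin (X.d i (i + 1)) (e x) = 0 := fun x => by
        simp only [e, LinearMap.sub_apply, LinearMap.id_apply, LinearMap.comp_apply, map_sub]
        rw [hs i (i + 1) rfl, sub_self]
      have hrange : ∀ x, lin (f.f i) (e x) ∈ LinearMap.range (lin (Y.d l i)) := fun x =>
        hf i l hl (e x) fun j => by
          by_cases hj : i + 1 = j
          · subst hj; exact he x
          · rw [X.shape i j hj]; rfl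
      obtain ⟨h, hh⟩ := Module.projective_lifting_property (lin (Y.d l i)).rangeRestrict
        ((lin (f.f i) ∘ₗ e).codRestrict _ hrange) (LinearMap.surjective_rangeRestrict _)
      exact ⟨ofLin h, fun _ x => congrArg Subtype.val (LinearMap.congr_fun hh x)⟩
    · exact ⟨0, fun h => absurd h hl⟩
  choose h hh using h1
  -- The term `f s` supplies the missing `f s d`; the last term cancels the surplus `f d s` and `h
  -- d`.
  refine (toKMap_eq_zero_iff f).2 ⟨fun i l => s i l ≫ f.f l + h i l - s i l ≫ X.d l i ≫ h i l, ?_⟩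
  rintro i _ l rfl hl x
  have h1 := hh i l hl x
  have h2 := hh i l hl (lin (X.d l i) (lin (s i l) x))
  have h3 := hs i _ rfl x
  simp only [lin_comp_apply, lin_add_apply, lin_sub_apply, map_add, map_sub, lin_comm, lin_d_lin_d,
    map_zero, sub_zero] at h1 h2 h3 ⊢
  rw [h1, h2, h3]
  abel

end Basic

end StableComplex

/-! ### Ghosts are the maps that vanish on cohomology -/

namespace StableComplex

open RelativeSyzygy

section Homology

variable {A : Type u} [Ring A]

lemma map_eq_zero_iff_of_natIso {C D : Type*} [Category* C] [Category* D] [HasZeroMorphisms D]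
    {F G : C ⥤ D} (e : F ≅ G) {X Y : C} (f : X ⟶ Y) : F.map f = 0 ↔ G.map f = 0 := by
  rw [← cancel_mono (e.hom.app Y), e.hom.naturality, zero_comp, ← cancel_epi (e.hom.app X),
    comp_zero]

lemma homologyMap_eq_zero_iff {K L : CochainComplex (ModuleCat.{u} A) ℤ} (f : K ⟶ L)
    (i j l : ℤ) (hij : i + 1 = j) (hli : l + 1 = i) :
    HomologicalComplex.homologyMap f i = 0 ↔
      ∀ x, K.d i j x = 0 → ∃ y, L.d l i y = f.f i x := by
  have hK := (ShortComplex.moduleCat_exact_iff _).1 (ShortComplex.exact_of_f_is_kernel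
    (ShortComplex.mk (K.iCycles i) (K.d i j) (K.iCycles_d i j))
    (K.cyclesIsKernel i j ((ComplexShape.up ℤ).next_eq' hij)))
  have hL := (ShortComplex.moduleCat_exact_iff _).1 (ShortComplex.exact_of_g_is_cokernel
    (ShortComplex.mk (L.toCycles l i) (L.homologyπ i) (L.toCycles_comp_homologyπ l i))
    (L.homologyIsCokernel l i ((ComplexShape.up ℤ).prev_eq' hli)))
  have hinj := (ModuleCat.mono_iff_injective (L.iCycles i)).1 inferInstance
  rw [← cancel_epi (K.homologyπ i), HomologicalComplex.homologyπ_naturality, comp_zero]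
  constructor
  · intro h x hx
    obtain ⟨c, rfl⟩ := hK x hx
    obtain ⟨y, hy⟩ := hL (HomologicalComplex.cyclesMap f i c) (ConcreteCategory.congr_hom h c)
    refine ⟨y, ?_⟩
    rw [← L.toCycles_i l i]
    exact (congrArg (L.iCycles i) hy).trans
      (ConcreteCategory.congr_hom (HomologicalComplex.cyclesMap_i f i) c)
  · intro h
    ext c
    obtain ⟨y, hy⟩ := h (K.iCycles i c) (ConcreteCategory.congr_hom (K.iCycles_d i j) c)
    have : L.toCycles l i y = HomologicalComplex.cyclesMap f i c := hinj (by
      rw [← L.toCycles_i l i] at hy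
      exact hy.trans (ConcreteCategory.congr_hom (HomologicalComplex.cyclesMap_i f i) c).symm)
    change L.homologyπ i (HomologicalComplex.cyclesMap f i c) = 0
    rw [← this]
    exact ConcreteCategory.congr_hom (L.toCycles_comp_homologyπ l i) y

variable {X Y Z : CochainComplex (FGProj A) ℤ}

lemma cohZero_iff_of_rel (f : X ⟶ Y) : CohZero f ↔ ∀ i j l : ℤ, i + 1 = j → l + 1 = i → ∀ x,
    lin (X.d i j) x = 0 → ∃ y, lin (Y.d l i) y = lin (f.f i) x := by
  refine ⟨fun h i j l hij hl x hx => h i l hl x fun j' => ?_,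
    fun h i l hl x hx => h i _ l rfl hl x (hx _)⟩
  by_cases hj : i + 1 = j'
  · rwa [← hj, hij]
  · rw [X.shape i j' hj]; rfl

lemma cohZero_iff (f : X ⟶ Y) : CohZero f ↔ ∀ i, (cohomology A i).map (toKMap f) = 0 := by
  let f' : ((isFGProj A).ι.mapHomologicalComplex (ComplexShape.up ℤ)).obj X ⟶
      ((isFGProj A).ι.mapHomologicalComplex (ComplexShape.up ℤ)).obj Y :=
    ((isFGProj A).ι.mapHomologicalComplex (ComplexShape.up ℤ)).map f
  have key : ∀ i, (cohomology A i).map (toKMap f) = 0 ↔ HomologicalComplex.homologyMap f' i = 0 :=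
    fun i => map_eq_zero_iff_of_natIso (HomotopyCategory.homologyFunctorFactors (ModuleCat.{u} A)
      (ComplexShape.up ℤ) i) f'
  rw [cohZero_iff_of_rel]
  simp_rw [key]
  constructor
  · exact fun h i => (homologyMap_eq_zero_iff _ i (i + 1) (i - 1) rfl (by lia)).2
      (h i _ _ rfl (by lia))
  · exact fun h i j l hij hl => (homologyMap_eq_zero_iff _ i j l hij hl).1 (h i)

/-- The regular module in degree `i`. -/
abbrev unitK (A : Type u) [Ring A] (i : ℤ) : KProj A :=
  toK ((HomologicalComplex.single (FGProj A) (ComplexShape.up ℤ) i).obj (regular A))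

lemma isSplit_unitK (i : ℤ) : IsSplit (unitK A i) :=
  isSplit_iff.2 ⟨fun _ _ => 0, fun a b _ x => by
    rw [HomologicalComplex.single_obj_d]; rfl⟩

/-- The chain map from the regular module in degree `i` given by a cycle. -/
def fromUnit (i : ℤ) (x : (X.X i).obj) (hx : ∀ j, lin (X.d i j) x = 0) :
    (HomologicalComplex.single (FGProj A) (ComplexShape.up ℤ) i).obj (regular A) ⟶ X :=
  HomologicalComplex.mkHomFromSingle
    (ofLin (M := regular A) (N := X.X i) (LinearMap.toSpanSingleton A (X.X i).obj x)) fun k _ =>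
      hom_ext_apply fun (r : A) =>
        (map_smul (lin (X.d i k)) r x).trans (by rw [hx, smul_zero]; rfl)

/-- The generator of the regular module in degree `i`. -/
def unitGen (A : Type u) [Ring A] (i : ℤ) :
    (((HomologicalComplex.single (FGProj A) (ComplexShape.up ℤ) i).obj (regular A)).X i).obj :=
  lin (HomologicalComplex.singleObjXSelf (ComplexShape.up ℤ) i (regular A)).inv (1 : A)

lemma fromUnit_unitGen (i : ℤ) (x : (X.X i).obj) (hx : ∀ j, lin (X.d i j) x = 0) :
    lin ((fromUnit i x hx).f i) (unitGen A i) = x := by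
  have h : (HomologicalComplex.singleObjXSelf (ComplexShape.up ℤ) i (regular A)).inv ≫
      (fromUnit i x hx).f i =
        ofLin (M := regular A) (N := X.X i) (LinearMap.toSpanSingleton A (X.X i).obj x) := by
    rw [fromUnit, HomologicalComplex.mkHomFromSingle_f, Iso.inv_hom_id_assoc]
  exact (congrArg (fun g => lin g (1 : A)) h).trans (one_smul A x)

lemma unitGen_cycle (i j : ℤ) : lin (((HomologicalComplex.single (FGProj A) (ComplexShape.up ℤ)
    i).obj (regular A)).d i j) (unitGen A i) = 0 := by
  rw [HomologicalComplex.single_obj_d]; rfl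

lemma eq_fromUnit (i : ℤ)
    (f : (HomologicalComplex.single (FGProj A) (ComplexShape.up ℤ) i).obj (regular A) ⟶ X) :
    f = fromUnit i (lin (f.f i) (unitGen A i)) fun j => by
      rw [lin_comm, unitGen_cycle, map_zero] := by
  apply HomologicalComplex.from_single_hom_ext
  rw [← cancel_epi (HomologicalComplex.singleObjXSelf (ComplexShape.up ℤ) i (regular A)).inv]
  refine lin_injective (LinearMap.ext_ring ?_)
  exact (fromUnit_unitGen i _ _).symm

/-- A cycle whose class is killed by a null-homotopic map is sent to a boundary. -/
lemma exists_boundary_of_fromUnit_comp {f : X ⟶ Y} (i l : ℤ) (hl : l + 1 = i) (x : (X.X i).obj)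
    (hx : ∀ j, lin (X.d i j) x = 0) (h : toKMap (fromUnit i x hx) ≫ toKMap f = 0) :
    ∃ y, lin (Y.d l i) y = lin (f.f i) x := by
  rw [← toKMap_comp] at h
  obtain ⟨k, hk⟩ := (toKMap_eq_zero_iff _).1 h
  have := hk i (i + 1) l rfl hl (unitGen A i)
  rw [HomologicalComplex.comp_f, lin_comp_apply, fromUnit_unitGen, unitGen_cycle, map_zero,
    zero_add] at this
  exact ⟨_, this.symm⟩

/-- Cycles are maps from shifted regular modules, which are split; conversely, cohomologically zero
maps out of split complexes are null-homotopic. -/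
lemma isGhost_toKMap_iff (f : X ⟶ Y) : IsGhost (IsSplit (A := A)) (toKMap f) ↔ CohZero f := by
  constructor
  · intro h i l hl x hx
    exact exists_boundary_of_fromUnit_comp i l hl x hx (h (isSplit_unitK i) _)
  · intro h P hP g
    obtain ⟨P, rfl⟩ := HomotopyCategory.quotient_obj_surjective P
    obtain ⟨g, rfl⟩ := toKMap_surjective g
    rw [← toKMap_comp]
    exact (h.comp_left g).toKMap_eq_zero hP

lemma isGhost_iff {X Y : KProj A} (f : X ⟶ Y) :
    IsGhost (IsSplit (A := A)) f ↔ ∀ i, (cohomology A i).map f = 0 := by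
  obtain ⟨X, rfl⟩ := HomotopyCategory.quotient_obj_surjective X
  obtain ⟨Y, rfl⟩ := HomotopyCategory.quotient_obj_surjective Y
  obtain ⟨f, rfl⟩ := toKMap_surjective f
  rw [isGhost_toKMap_iff, cohZero_iff]

instance (i : ℤ) : (cohomology A i).IsHomological := by
  unfold cohomology; infer_instance

lemma isCohSurjective_iff {X Y Z : KProj A} {f : X ⟶ Y} {g : Y ⟶ Z} {δ : Z ⟶ X⟦(1 : ℤ)⟧}
    (hT : Triangle.mk f g δ ∈ distTriang (KProj A)) :
    IsCohSurjective g ↔ IsGhost (IsSplit (A := A)) δ := by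
  rw [isGhost_iff]
  refine forall_congr' fun i => ?_
  have hex := Functor.IsHomological.exact (F := cohomology A i) _ (rotate_distinguished hT)
  rw [← ModuleCat.epi_iff_surjective]
  refine ⟨fun h => ?_, fun h => hex.epi_f h⟩
  rw [← cancel_epi ((cohomology A i).map g), comp_zero, ← Functor.map_comp]
  exact (congrArg _ (comp_distTriang_mor_zero₂₃ _ hT)).trans (Functor.map_zero _ _ _)

/-- The fibre of `f` maps to `X` by a ghost, because split complexes are stable under shift and the
suspension of a test map lifts along `δ`. -/
lemma mono_cohomology_map {X Y Z : KProj A} {f : X ⟶ Y} {g : Y ⟶ Z} {δ : Z ⟶ X⟦(1 : ℤ)⟧}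
    (hT : Triangle.mk f g δ ∈ distTriang (KProj A)) (hS : IsShiftAdditive (IsSplit (A := A)))
    (hδ : IsGhost (IsSplit (A := A)) δ) (i : ℤ) : Mono ((cohomology A i).map f) := by
  obtain ⟨W, w, g', hT'⟩ := distinguished_cocone_triangle₁ f
  have hex := Functor.IsHomological.exact (F := cohomology A i) _ hT'
  refine hex.mono_g ((isGhost_iff w).1 (fun P hP a => ?_) i)
  apply (shiftFunctor (KProj A) (1 : ℤ)).map_injective
  obtain ⟨l, hl⟩ := exists_lift_of_comp_shift_eq_zero hT ((a ≫ w)⟦(1 : ℤ)⟧') (by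
    have : w ≫ f = 0 := comp_distTriang_mor_zero₁₂ _ hT'
    rw [← Functor.map_comp, Category.assoc, this, comp_zero, Functor.map_zero])
  rw [hl, Functor.map_zero]
  exact hδ (hS.shift P 1 hP) l

lemma isCohGhost_iff (hS : IsShiftAdditive (IsSplit (A := A))) {X Y Z : KProj A} (f : X ⟶ Y)
    (g : Y ⟶ Z) (δ : Z ⟶ X⟦(1 : ℤ)⟧) :
    IsCohGhost (Triangle.mk f g δ) ↔ Triangle.mk f g δ ∈ distTriang (KProj A) ∧
      IsGhost (IsSplit (A := A)) δ := by
  constructor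
  · rintro ⟨hT, h⟩
    exact ⟨hT, (isCohSurjective_iff hT).1 fun i =>
      (ModuleCat.epi_iff_surjective _).1 (h i).epi_g⟩
  · rintro ⟨hT, h⟩
    exact ⟨hT, fun i =>
      { exact := Functor.IsHomological.exact (F := cohomology A i) _ hT
        mono_f := mono_cohomology_map hT hS h i
        epi_g := (ModuleCat.epi_iff_surjective _).2 ((isCohSurjective_iff hT).2 h i) }⟩

end Homology

end StableComplex

/-! ### The category `Add A`, syzygies and projective dimension -/

namespace StableComplex

open RelativeSyzygy

section Approximation

variable {A : Type u} [Ring A] {X Y Z : CochainComplex (FGProj A) ℤ}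

/-- The free complex with zero differential and ranks `n i`. -/
abbrev freeCpx (A : Type u) [Ring A] (n : ℤ → ℕ) : CochainComplex (FGProj A) ℤ :=
  zeroCpx fun i => fgProj (A := A) (Fin (n i) → A)

lemma exists_free_onto_cycles [IsNoetherianRing A] (X : CochainComplex (FGProj A) ℤ) :
    ∃ (n : ℤ → ℕ) (p : freeCpx A n ⟶ X), ∀ i x, (∀ j, lin (X.d i j) x = 0) →
      ∃ y, lin (p.f i) y = x := by
  have h1 : ∀ i, ∃ (n : ℕ) (φ : (Fin n → A) →ₗ[A] (X.X i).obj),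
      LinearMap.range φ = LinearMap.ker (lin (X.d i (i + 1))) := fun i => by
    obtain ⟨n, f, hf⟩ := Module.Finite.exists_fin' A (LinearMap.ker (lin (X.d i (i + 1))))
    refine ⟨n, (LinearMap.ker (lin (X.d i (i + 1)))).subtype ∘ₗ f, ?_⟩
    rw [LinearMap.range_comp, LinearMap.range_eq_top.2 hf, Submodule.map_top,
      Submodule.range_subtype]
  choose n φ hφ using h1
  refine ⟨n, fromZeroCpx _ φ fun i j x => ?_, fun i x hx => ?_⟩
  · by_cases hij : i + 1 = j
    · subst hij
      have : φ i x ∈ LinearMap.range (φ i) := ⟨x, rfl⟩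
      rwa [hφ] at this
    · rw [X.shape i j hij]; rfl
  · have : x ∈ LinearMap.range (φ i) := by rw [hφ]; exact hx _
    exact this

lemma exists_cone_distinguished (f : X ⟶ Y) :
    ∃ δ, Triangle.mk (toKMap f) (toKMap (CochainComplex.mappingCone.inr f)) δ ∈
      distTriang (KProj A) :=
  ⟨_, HomotopyCategory.mappingCone_triangleh_distinguished f⟩

/-- In the cone the cycle `p y` is the boundary of `y`, since the source of `p` has no differential.
-/
lemma cohZero_inr {F : ℤ → FGProj A} (p : zeroCpx F ⟶ X)
    (hp : ∀ i x, (∀ j, lin (X.d i j) x = 0) → ∃ y, lin (p.f i) y = x) :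
    CohZero (CochainComplex.mappingCone.inr p) := by
  intro i l hl x hx
  obtain ⟨y, rfl⟩ := hp i x hx
  have h := CochainComplex.mappingCone.inl_v_d p i l (i + 1) (by lia) (by lia)
  rw [zeroCpx_d, zero_comp, sub_zero] at h
  exact ⟨lin ((CochainComplex.mappingCone.inl p).v i l (by lia)) y,
    congrArg (fun g => lin g y) h⟩

/-- A complex all of whose ghost maps vanish is a retract of a free complex with zero
differential. -/
lemma exists_retract_freeCpx [IsNoetherianRing A]
    (h : ∀ (Y : CochainComplex (FGProj A) ℤ) (f : X ⟶ Y), CohZero f → toKMap f = 0) :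
    ∃ n, Nonempty (Retract (toK X) (toK (freeCpx A n))) := by
  obtain ⟨n, p, hp⟩ := exists_free_onto_cycles X
  obtain ⟨δ, hδ⟩ := exists_cone_distinguished p
  obtain ⟨s, hs⟩ : ∃ s : toK X ⟶ toK (freeCpx A n), 𝟙 _ = s ≫ toKMap p :=
    Triangle.coyoneda_exact₂ _ hδ (𝟙 (toK X))
      ((Category.id_comp _).trans (h _ _ (cohZero_inr p hp)))
  exact ⟨n, ⟨s, toKMap p, hs.symm⟩⟩

lemma isSplit_iff_retract [IsNoetherianRing A] (X : KProj A) :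
    IsSplit X ↔ ∃ n, Nonempty (Retract X (toK (freeCpx A n))) := by
  obtain ⟨X, rfl⟩ := HomotopyCategory.quotient_obj_surjective X
  exact ⟨fun h => exists_retract_freeCpx fun _ _ hf => hf.toKMap_eq_zero h,
    fun ⟨_, h⟩ => isSplit_of_retract h (isSplit_zeroCpx _)⟩

/-- The shifts of the regular module. -/
def unitShiftIso (A : Type u) [Ring A] (n i j : ℤ) (h : n + i = j) :
    (unitK A j)⟦n⟧ ≅ unitK A i :=
  ((HomotopyCategory.singleFunctors (FGProj A)).shiftIso n i j h).app (regular A)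

/-- Objects such that every morphism out of them which vanishes on the shifts of the regular
module is zero. -/
def unitDetected (A : Type u) [Ring A] : ObjectProperty (KProj A) := fun X =>
  ∀ (Y : KProj A) (f : X ⟶ Y), (∀ i (a : unitK A i ⟶ X), a ≫ f = 0) → f = 0

lemma isAddClosed_unitDetected : IsAddClosed (unitDetected A) where
  unit Y f hf := (Category.id_comp f).symm.trans (hf 0 (𝟙 _))
  shift X n hX Y f hf := by
    let e : X ≅ (X⟦n⟧)⟦-n⟧ := (shiftShiftNeg X n).symm
    have h : e.hom ≫ f⟦-n⟧' = 0 := hX _ _ fun i a => by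
      have h1 : (unitShiftIso A n (i - n) i (by lia)).inv ≫ a⟦n⟧' ≫ f = 0 := by
        rw [← Category.assoc]; exact hf _ _
      rw [Preadditive.IsIso.comp_left_eq_zero] at h1
      have h2 : a ≫ e.hom = (shiftShiftNeg (unitK A i) n).inv ≫ (a⟦n⟧')⟦-n⟧' :=
        ((shiftFunctorCompIsoId (KProj A) n (-n) (add_neg_cancel n)).inv.naturality a)
      rw [reassoc_of% h2, ← Functor.map_comp, h1, Functor.map_zero, comp_zero]
    rw [Preadditive.IsIso.comp_left_eq_zero] at h
    exact (shiftFunctor (KProj A) (-n)).map_injective (h.trans (Functor.map_zero _ _ _).symm)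
  summand X Y := by
    rintro ⟨⟨i, r, hir⟩⟩ hY Z f hf
    have h : r ≫ f = 0 := hY _ _ fun j a => by rw [← Category.assoc]; exact hf _ _
    rw [← Category.id_comp f, ← hir, Category.assoc, h, comp_zero]
  coproduct J X c := by
    rintro ⟨hc⟩ hX Z f hf
    refine Cofan.IsColimit.hom_ext hc _ _ fun j => ?_
    rw [comp_zero]
    exact hX j _ _ fun i a => by rw [← Category.assoc]; exact hf _ _

/-- The inclusions which exhibit a free complex with zero differential as a coproduct. -/
def freeInclusion (n : ℤ → ℕ) (j : Σ i : ℤ, Fin (n i)) :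
    (HomologicalComplex.single (FGProj A) (ComplexShape.up ℤ) j.1).obj (regular A) ⟶
      freeCpx A n :=
  fromUnit (X := freeCpx A n) j.1 (Pi.single j.2 1 : Fin (n j.1) → A) fun _ => rfl

lemma cohZero_of_freeInclusion_comp {n : ℤ → ℕ} {f : freeCpx A n ⟶ X}
    (h : ∀ j, toKMap (freeInclusion n j) ≫ toKMap f = 0) : CohZero f := by
  intro i l hl x _
  have h1 : ∀ k : Fin (n i), (lin (f.f i) (Pi.single k 1 : Fin (n i) → A)) ∈
      LinearMap.range (lin (X.d l i)) := fun k =>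
    exists_boundary_of_fromUnit_comp (X := freeCpx A n) i l hl _ _ (h ⟨i, k⟩)
  have h2 : (LinearMap.range (lin (X.d l i))).mkQ ∘ₗ
      (show (Fin (n i) → A) →ₗ[A] (X.X i).obj from lin (f.f i)) = 0 :=
    LinearMap.pi_ext' fun k => LinearMap.ext_ring
      ((Submodule.Quotient.mk_eq_zero _).2 (h1 k))
  exact (Submodule.Quotient.mk_eq_zero _).1 (LinearMap.congr_fun h2 x)

lemma freeCpx_hom_ext {n : ℤ → ℕ} {Y : KProj A} {f g : toK (freeCpx A n) ⟶ Y}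
    (h : ∀ j, toKMap (freeInclusion n j) ≫ f = toKMap (freeInclusion n j) ≫ g) : f = g := by
  obtain ⟨Y, rfl⟩ := HomotopyCategory.quotient_obj_surjective Y
  obtain ⟨k, hk⟩ := toKMap_surjective (f - g)
  rw [← sub_eq_zero, ← hk]
  refine (cohZero_of_freeInclusion_comp fun j => ?_).toKMap_eq_zero (isSplit_zeroCpx _)
  rw [hk, Preadditive.comp_sub, h, sub_self]

/-- The cofan of the inclusions into a free complex with zero differential. -/
abbrev freeCofan (A : Type u) [Ring A] (n : ℤ → ℕ) :
    Cofan fun j : ULift.{u} (Σ i : ℤ, Fin (n i)) => unitK A j.down.1 :=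
  Cofan.mk (toK (freeCpx A n)) fun j => toKMap (freeInclusion n j.down)

/-- The coproduct may be infinite, but it has finitely many summands in each degree, so it exists
among complexes of finitely generated projectives. The `ULift` puts the index set in the universe
used by `IsAddClosed`. -/
lemma nonempty_isColimit_freeCofan (n : ℤ → ℕ) : Nonempty (IsColimit (freeCofan A n)) := by
  have hdesc : ∀ (Y : KProj A) (g : ∀ j : Σ i : ℤ, Fin (n i), unitK A j.1 ⟶ Y),
      ∃ f : toK (freeCpx A n) ⟶ Y, ∀ j, toKMap (freeInclusion n j) ≫ f = g j := by
    intro Y g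
    obtain ⟨Y, rfl⟩ := HomotopyCategory.quotient_obj_surjective Y
    choose γ hγ using fun j => toKMap_surjective (g j)
    have hcyc : ∀ (i : ℤ) (k : Fin (n i)) (j : ℤ),
        lin (Y.d i j) (lin ((γ ⟨i, k⟩).f i) (unitGen A i)) = 0 := fun i k j => by
      rw [lin_comm, unitGen_cycle, map_zero]
    let φ : ∀ i, (Fin (n i) → A) →ₗ[A] (Y.X i).obj := fun i =>
      Fintype.linearCombination A fun k => lin ((γ ⟨i, k⟩).f i) (unitGen A i)
    have hφ : ∀ i j x, lin (Y.d i j) (φ i x) = 0 := fun i j x => by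
      simp only [φ, Fintype.linearCombination_apply, map_sum, map_smul, hcyc, smul_zero,
        Finset.sum_const_zero]
    refine ⟨toKMap (fromZeroCpx _ φ hφ), fun j => ?_⟩
    rw [← toKMap_comp, ← hγ j]
    congr 1
    obtain ⟨i, k⟩ := j
    rw [eq_fromUnit i (γ ⟨i, k⟩), eq_fromUnit i (freeInclusion n ⟨i, k⟩ ≫ _)]
    congr 1
    rw [HomologicalComplex.comp_f, lin_comp_apply]
    refine (congrArg _ (fromUnit_unitGen (X := freeCpx A n) i _ _)).trans ?_
    change Fintype.linearCombination A _ (Pi.single k 1) = _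
    rw [Fintype.linearCombination_apply_single, one_smul]
  choose desc hd using hdesc
  exact ⟨Cofan.IsColimit.mk _ (fun s => desc s.pt fun j => s.inj ⟨j⟩)
    (fun s j => hd s.pt (fun j => s.inj ⟨j⟩) j.down) fun s m hm =>
      freeCpx_hom_ext fun j => (hm ⟨j⟩).trans (hd s.pt (fun j => s.inj ⟨j⟩) j).symm⟩

lemma isSplit_of_ghost_eq_zero [IsNoetherianRing A] {X : KProj A}
    (h : ∀ (Y : KProj A) (f : X ⟶ Y), IsGhost (IsSplit (A := A)) f → f = 0) : IsSplit X := by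
  obtain ⟨X, rfl⟩ := HomotopyCategory.quotient_obj_surjective X
  exact (isSplit_iff_retract _).2 (exists_retract_freeCpx fun Y f hf =>
    h _ _ ((isGhost_toKMap_iff f).2 hf))

lemma addSubcategory_iff [IsNoetherianRing A] (X : KProj A) : addSubcategory A X ↔ IsSplit X := by
  constructor
  · intro h
    exact isSplit_of_ghost_eq_zero fun Y f hf => h _ isAddClosed_unitDetected Y f fun i a =>
      hf (isSplit_unitK i) a
  · intro h P hP
    obtain ⟨n, hn⟩ := (isSplit_iff_retract X).1 h
    refine hP.summand _ _ hn (hP.coproduct _ _ (freeCofan A n) (nonempty_isColimit_freeCofan n)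
      fun j => ?_)
    exact hP.summand _ _ ⟨(unitShiftIso A (-j.down.1) j.down.1 0 (by lia)).symm.retract⟩
      (hP.shift _ _ hP.unit)

lemma isShiftAdditive_isSplit [IsNoetherianRing A] : IsShiftAdditive (IsSplit (A := A)) where
  biprod X Y hX hY := isSplit_of_ghost_eq_zero fun Z f hf => by
    ext
    · exact (hf hX biprod.inl).trans comp_zero.symm
    · exact (hf hY biprod.inr).trans comp_zero.symm
  shift X n hX := by
    rw [← addSubcategory_iff] at hX ⊢
    exact fun P hP => hP.shift X n (hX P hP)
  retract X Y h hY := isSplit_of_retract h hY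

lemma exists_relSyzygy [IsNoetherianRing A] (X : KProj A) :
    ∃ W, IsRelSyzygy (IsSplit (A := A)) W X := by
  obtain ⟨X, rfl⟩ := HomotopyCategory.quotient_obj_surjective X
  obtain ⟨n, p, hp⟩ := exists_free_onto_cycles X
  obtain ⟨δ, hδ⟩ := exists_cone_distinguished p
  obtain ⟨W, q, δ', hT⟩ := distinguished_cocone_triangle₁ (toKMap p)
  refine ⟨W, _, isSplit_zeroCpx _, q, toKMap p, δ', hT, fun P hP a => ?_⟩
  have h1 := (isGhost_toKMap_iff _).2 (cohZero_inr p hp) hP a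
  obtain ⟨b, hb⟩ : ∃ b : P ⟶ toK (freeCpx A n), a = b ≫ toKMap p :=
    Triangle.coyoneda_exact₂ _ hδ a h1
  rw [hb, Category.assoc]
  exact (congrArg _ (comp_distTriang_mor_zero₂₃ _ hT)).trans comp_zero

lemma isSyzygy_iff [IsNoetherianRing A] (X W : KProj A) :
    IsSyzygy X W ↔ IsRelSyzygy (IsSplit (A := A)) W X := by
  constructor
  · rintro ⟨P, q, p, δ, ⟨hP, hp⟩, hT⟩
    refine ⟨P, (addSubcategory_iff P).1 hP, q, p, δ, hT, fun W' hW' a => ?_⟩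
    obtain ⟨h, rfl⟩ := hp W' ((addSubcategory_iff W').2 hW') a
    rw [Category.assoc]
    exact (congrArg _ (comp_distTriang_mor_zero₂₃ _ hT)).trans comp_zero
  · rintro ⟨P, hP, q, p, δ, hT, hδ⟩
    refine ⟨P, q, p, δ, ⟨(addSubcategory_iff P).2 hP, fun W' hW' a => ?_⟩, hT⟩
    obtain ⟨l, hl⟩ := exists_lift_of_comp_eq_zero hT a
      (hδ ((addSubcategory_iff W').1 hW') a)
    exact ⟨l, hl.symm⟩

lemma isNthSyzygy_iff [IsNoetherianRing A] (n : ℕ) (X W : KProj A) :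
    IsNthSyzygy n X W ↔ IsNthRelSyzygy (IsSplit (A := A)) n X W := by
  induction n generalizing W with
  | zero => rfl
  | succ n ih => exact exists_congr fun V => and_congr (ih V) (isSyzygy_iff V W)

lemma exists_isNthSyzygy [IsNoetherianRing A] (n : ℕ) (X : KProj A) :
    ∃ W, IsNthSyzygy n X W := by
  induction n with
  | zero => exact ⟨X, ⟨Iso.refl X⟩⟩
  | succ n ih =>
    obtain ⟨V, hV⟩ := ih
    obtain ⟨W, hW⟩ := exists_relSyzygy V
    exact ⟨W, V, hV, (isSyzygy_iff V W).2 hW⟩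

lemma isRelSyzygy_of_iso {W X X' : KProj A} (h : IsRelSyzygy (IsSplit (A := A)) W X)
    (e : X ≅ X') : IsRelSyzygy (IsSplit (A := A)) W X' := by
  obtain ⟨P, hP, h⟩ := h
  exact ⟨P, hP, h.of_iso_right e⟩

lemma hasResolution_one_iff [IsNoetherianRing A] (X : KProj A) :
    HasResolution (IsSplit (A := A)) 1 X ↔ IsSplit X := by
  constructor
  · rintro ⟨Y, ⟨P, hP, f, g, δ, hT, -⟩, hY⟩
    have : IsIso g := (Triangle.isZero₁_iff_isIso₂ _ hT).1 hY
    exact isShiftAdditive_isSplit.of_iso (asIso g) hP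
  · intro h
    exact ⟨_, ⟨X, h, _, _, _, contractible_distinguished₁ X, fun _ _ _ => comp_zero⟩,
      isZero_zero _⟩

lemma hasResolution_succ [IsNoetherianRing A] (m : ℕ) {X : KProj A}
    (h : HasResolution (IsSplit (A := A)) m X) : HasResolution (IsSplit (A := A)) (m + 1) X := by
  induction m generalizing X with
  | zero =>
    -- A zero object is split, being a retract of the regular module through zero maps.
    refine (hasResolution_one_iff X).2 (isShiftAdditive_isSplit.retract X (unitK A 0)
      ⟨⟨0, 0, IsZero.eq_of_src h _ _⟩⟩ (isSplit_unitK 0))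
  | succ m ih =>
    obtain ⟨Y, hY, h⟩ := h
    exact ⟨Y, hY, ih h⟩

lemma HasSplitResolution.hasResolution [IsNoetherianRing A] (n : ℕ) {X : KProj A}
    (h : HasSplitResolution n X) : HasResolution (IsSplit (A := A)) (n + 1) X := by
  induction n generalizing X with
  | zero =>
    obtain ⟨Z, ⟨e⟩, hZ, -⟩ := h
    exact (hasResolution_one_iff X).2 (isShiftAdditive_isSplit.of_iso e hZ)
  | succ n ih =>
    obtain ⟨Z, ⟨e⟩, hZ, h⟩ := h
    obtain ⟨P, g, f, δ, hT, hP, hf⟩ := h 0 (by lia)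
    exact ⟨Z 1, isRelSyzygy_of_iso ⟨P, hP, g, f, δ, hT, (isCohSurjective_iff hT).1 hf⟩ e,
      ih ⟨fun i => Z (i + 1), ⟨Iso.refl _⟩, hZ, fun i hi => h (i + 1) (by lia)⟩⟩

lemma HasSplitResolution.of_iso {n : ℕ} {X X' : KProj A} (h : HasSplitResolution n X)
    (e : X ≅ X') : HasSplitResolution n X' := by
  obtain ⟨Z, ⟨e'⟩, h⟩ := h
  exact ⟨Z, ⟨e' ≪≫ e⟩, h⟩

lemma hasSplitResolution_of_hasResolution [IsNoetherianRing A] (n : ℕ) {X : KProj A}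
    (h : HasResolution (IsSplit (A := A)) (n + 1) X) : HasSplitResolution n X := by
  induction n generalizing X with
  | zero =>
    exact ⟨fun _ => X, ⟨Iso.refl X⟩, (hasResolution_one_iff X).1 h, fun i hi => by lia⟩
  | succ n ih =>
    obtain ⟨Y, ⟨P, hP, f, g, δ, hT, hδ⟩, hY⟩ := h
    obtain ⟨Z, ⟨e⟩, hZ, h⟩ := ih hY
    refine ⟨fun i => Nat.casesOn i X Z, ⟨Iso.refl X⟩, hZ, fun i hi => ?_⟩
    obtain _ | i := i
    -- `Z 0` is only isomorphic to the syzygy `Y`, so the first triangle is transported along `e`.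
    · have hT' : Triangle.mk (e.hom ≫ f) g (δ ≫ e.inv⟦(1 : ℤ)⟧') ∈ distTriang (KProj A) := by
        refine isomorphic_distinguished _ hT _
          (Triangle.isoMk _ _ e (Iso.refl _) (Iso.refl _) ?_ ?_ ?_)
        · exact Category.comp_id _
        · exact (Category.comp_id _).trans (Category.id_comp _).symm
        · change (δ ≫ e.inv⟦(1 : ℤ)⟧') ≫ e.hom⟦(1 : ℤ)⟧' = 𝟙 _ ≫ δ
          rw [Category.assoc, ← Functor.map_comp, e.inv_hom_id, CategoryTheory.Functor.map_id,
            Category.comp_id, Category.id_comp]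
      exact ⟨P, _, g, _, hT', hP, (isCohSurjective_iff hT').2 (hδ.comp_right _)⟩
    · exact h i (by lia)

/-- The index moves by one because `HasResolution` counts split terms and ends at zero, while a
split resolution of length `n` ends at a split complex. -/
lemma projDim_le_iff [IsNoetherianRing A] (n : ℕ) (X : KProj A) :
    projDim X ≤ n ↔ HasResolution (IsSplit (A := A)) (n + 1) X := by
  constructor
  · intro h
    have hne : {m : ℕ∞ | ∃ n : ℕ, m = n ∧ HasSplitResolution n X}.Nonempty := by
      by_contra hne
      rw [Set.not_nonempty_iff_eq_empty] at hne
      rw [projDim, hne, sInf_empty] at h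
      exact ENat.natCast_ne_top n (top_le_iff.1 h)
    obtain ⟨k, hk, hres⟩ := csInf_mem hne
    have hkn : k ≤ n := by
      rw [projDim, hk] at h
      exact_mod_cast h
    exact Nat.le_induction hres.hasResolution (fun m _ h => hasResolution_succ _ h) n hkn
  · intro h
    exact sInf_le ⟨n, rfl, hasSplitResolution_of_hasResolution n h⟩

end Approximation

end StableComplex

/-! ### The conditions `O` and `T`: homotopy invariance and reflexivity -/

namespace StableComplex

open RelativeSyzygy

section CokerExt

variable {A : Type u} [Ring A] (E : Type u) [AddCommGroup E] [Module A E]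

/-- The vanishing of `Extʲ_A(Cⁱ(X), E)` for all `i`. -/
def CokerExtVanish (j : ℕ) (X : KProj A) : Prop :=
  ∀ i k : ℤ, i + 1 = k →
    ExtVanish (A := A) E j ((X.as.X k).obj ⧸ LinearMap.range (lin (X.as.d i k)))

variable {E}

/-- A homotopy descends to `coker d₀`: the part `d₀ h` disappears there and the part `k d₁` factors
through the projective `M₂`. -/
lemma ExtVanish.of_homotopy {M₀ M₁ M₂ N₀ N₁ : Type u} [AddCommGroup M₀] [Module A M₀]
    [AddCommGroup M₁] [Module A M₁] [AddCommGroup M₂] [Module A M₂] [AddCommGroup N₀] [Module A N₀]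
    [AddCommGroup N₁] [Module A N₁] [Module.Projective A M₂] {d₀ : M₀ →ₗ[A] M₁} {e : N₀ →ₗ[A] N₁}
    {j : ℕ} (hN : ExtVanish (A := A) E (j + 1) (N₁ ⧸ LinearMap.range e))
    (d₁ : M₁ →ₗ[A] M₂) (hd : ∀ x, d₁ (d₀ x) = 0) (f : M₁ →ₗ[A] N₁) (g : N₁ →ₗ[A] M₁)
    (k : M₂ →ₗ[A] M₁) (hf : ∀ x, f (d₀ x) ∈ LinearMap.range e)
    (hg : ∀ y, g (e y) ∈ LinearMap.range d₀)
    (h : ∀ x, g (f x) + k (d₁ x) - x ∈ LinearMap.range d₀) :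
    ExtVanish (A := A) E (j + 1) (M₁ ⧸ LinearMap.range d₀) := by
  refine hN.of_factor
    ((LinearMap.range d₀).mapQ (LinearMap.range e) f (by rintro _ ⟨x, rfl⟩; exact hf x))
    ((LinearMap.range e).mapQ (LinearMap.range d₀) g (by rintro _ ⟨x, rfl⟩; exact hg x))
    ((LinearMap.range d₀).liftQ d₁ (by rintro _ ⟨x, rfl⟩; exact hd x))
    ((LinearMap.range d₀).mkQ ∘ₗ k) ?_
  ext x
  rw [← sub_eq_zero]
  exact (Submodule.Quotient.mk_eq_zero _).2 (h x)

lemma exists_homotopyEquiv {X Y : CochainComplex (FGProj A) ℤ} (e : toK X ≅ toK Y) :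
    ∃ (f : X ⟶ Y) (g : Y ⟶ X) (h : ∀ i j : ℤ, X.X i ⟶ X.X j), ∀ i j l, i + 1 = j → l + 1 = i →
      ∀ x, lin (g.f i) (lin (f.f i) x) =
        lin (h j i) (lin (X.d i j) x) + lin (X.d l i) (lin (h i l) x) + x := by
  obtain ⟨f, hf⟩ := toKMap_surjective e.hom
  obtain ⟨g, hg⟩ := toKMap_surjective e.inv
  obtain ⟨h, hh⟩ := exists_homotopy_of_toKMap_eq (f := f ≫ g) (g := 𝟙 X) (by
    rw [toKMap_comp, hf, hg, e.hom_inv_id]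
    exact (CategoryTheory.Functor.map_id _ _).symm)
  exact ⟨f, g, h, hh⟩

lemma CokerExtVanish.of_iso {j : ℕ} {X Y : KProj A} (h : CokerExtVanish E (j + 1) Y) (e : X ≅ Y) :
    CokerExtVanish E (j + 1) X := by
  obtain ⟨X, rfl⟩ := HomotopyCategory.quotient_obj_surjective X
  obtain ⟨Y, rfl⟩ := HomotopyCategory.quotient_obj_surjective Y
  obtain ⟨f, g, s, hs⟩ := exists_homotopyEquiv e
  rintro i k hik
  refine (h i k hik).of_homotopy (lin (X.d k (k + 1))) (lin_d_lin_d _ _ _) (lin (f.f k))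
    (lin (g.f k)) (-lin (s (k + 1) k)) (fun x => ⟨lin (f.f i) x, lin_comm _ _ _ _⟩)
    (fun y => ⟨lin (g.f i) y, lin_comm _ _ _ _⟩) fun (x : (X.X k).obj) => ⟨lin (s k i) x, ?_⟩
  have := hs k (k + 1) i rfl hik x
  change lin (X.d i k) (lin (s k i) x) =
    lin (g.f k) (lin (f.f k) x) + -lin (s (k + 1) k) (lin (X.d k (k + 1)) x) - x
  rw [this]
  abel

lemma cokerExtVanish_congr {j : ℕ} {X Y : KProj A} (e : X ≅ Y) :
    CokerExtVanish E (j + 1) X ↔ CokerExtVanish E (j + 1) Y :=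
  ⟨fun h => h.of_iso e.symm, fun h => h.of_iso e⟩

lemma cokerExtVanish_shift {j : ℕ} (X : KProj A) :
    CokerExtVanish E (j + 1) (X⟦(1 : ℤ)⟧) ↔ CokerExtVanish E (j + 1) X := by
  obtain ⟨X, rfl⟩ := HomotopyCategory.quotient_obj_surjective X
  let δ : ∀ i k : ℤ, (X.X (i + 1)).obj →ₗ[A] (X.X (k + 1)).obj := fun i k =>
    lin ((X⟦(1 : ℤ)⟧).d i k)
  have hd : ∀ i k : ℤ, LinearMap.range (δ i k) = LinearMap.range (lin (X.d (i + 1) (k + 1))) :=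
    fun i k => by
      have : δ i k = -lin (X.d (i + 1) (k + 1)) := by
        simp only [δ]
        rw [CochainComplex.shiftFunctor_obj_d']
        simp only [Int.negOnePow_one, Units.neg_smul, one_smul]
        rfl
      rw [this, LinearMap.range_neg]
  refine (cokerExtVanish_congr (((HomotopyCategory.quotient (FGProj A)
    (ComplexShape.up ℤ)).commShiftIso (1 : ℤ)).symm.app X)).trans ?_
  constructor
  · intro h i k hik
    obtain ⟨i, rfl⟩ : ∃ i', i = i' + 1 := ⟨i - 1, by lia⟩
    obtain ⟨k, rfl⟩ : ∃ k', k = k' + 1 := ⟨k - 1, by lia⟩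
    have : ExtVanish (A := A) E (j + 1) (_ ⧸ LinearMap.range (δ i k)) := h i k (by lia)
    rwa [hd] at this
  · intro h i k hik
    have := h (i + 1) (k + 1) (by lia)
    change ExtVanish (A := A) E (j + 1) (_ ⧸ LinearMap.range (δ i k))
    rwa [hd]

end CokerExt

section DualCokerExt

variable (A B E : Type u) [Ring A] [Ring B] [AddCommGroup E] [Module A E] [Module B E]
  [SMulCommClass A B E]

/-- The vanishing of `Extʲ_B(Cⁱ(X*), E)` for all `i`. -/
def DualCokerExtVanish (j : ℕ) (X : KProj A) : Prop :=
  ∀ i k : ℤ, i + 1 = k → ExtVanish (A := B) E j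
    (((X.as.X i).obj →ₗ[A] E) ⧸ LinearMap.range (LinearMap.lcomp B E (lin (X.as.d i k))))

variable {A B E} [Module.Finite B E] [Module.Projective B E]

instance dual_finite (M : FGProj A) : Module.Finite B (M.obj →ₗ[A] E) :=
  (dual_fgProj A B E M.obj).1

instance dual_projective (M : FGProj A) : Module.Projective B (M.obj →ₗ[A] E) :=
  (dual_fgProj A B E M.obj).2

lemma isTorsionfree_iff (n : ℕ) (X : KProj A) :
    IsTorsionfree A B E n X ↔ UpTo (DualCokerExtVanish A B E) n X := by
  constructor
  · intro h j h1 h2 i k hik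
    obtain ⟨a, rfl⟩ : ∃ a, i = -a := ⟨-i, by lia⟩
    obtain rfl : k = -(a - 1) := by lia
    exact h a j h1 h2
  · intro h i j h1 h2
    exact h j h1 h2 (-i) (-(i - 1)) (by lia)

lemma DualCokerExtVanish.of_iso {j : ℕ} {X Y : KProj A} (h : DualCokerExtVanish A B E (j + 1) Y)
    (e : X ≅ Y) : DualCokerExtVanish A B E (j + 1) X := by
  obtain ⟨X, rfl⟩ := HomotopyCategory.quotient_obj_surjective X
  obtain ⟨Y, rfl⟩ := HomotopyCategory.quotient_obj_surjective Y
  obtain ⟨f, g, s, hs⟩ := exists_homotopyEquiv e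
  rintro i k hik
  refine (h i k hik).of_homotopy (LinearMap.lcomp B E (lin (X.d (i - 1) i))) (fun φ => ?_)
    (LinearMap.lcomp B E (lin (g.f i))) (LinearMap.lcomp B E (lin (f.f i)))
    (-LinearMap.lcomp B E (lin (s i (i - 1)))) (fun φ => ⟨φ ∘ₗ lin (g.f k), ?_⟩)
    (fun φ => ⟨φ ∘ₗ lin (f.f k), ?_⟩) fun (φ : (X.X i).obj →ₗ[A] E) => ⟨φ ∘ₗ lin (s k i), ?_⟩
  · ext x
    exact (congrArg φ (lin_d_lin_d (X := X) _ _ _ x)).trans (map_zero φ)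
  · ext y
    exact congrArg φ (lin_comm g i k y).symm
  · ext x
    exact congrArg φ (lin_comm f i k x).symm
  · ext (x : (X.X i).obj)
    have := congrArg φ (hs i k (i - 1) hik (by lia) x)
    have := this.trans ((map_add φ _ _).trans (congrArg (· + _) (map_add φ _ _)))
    change φ (lin (s k i) (lin (X.d i k) x)) = φ (lin (g.f i) (lin (f.f i) x)) +
      -φ (lin (X.d (i - 1) i) (lin (s i (i - 1)) x)) - φ x
    rw [this]
    abel

end DualCokerExt

section Reflexive

variable {R : Type u} [Ring R]

lemma exists_dual_basis (M : Type u) [AddCommGroup M] [Module Rᵐᵒᵖ M] [Module.Finite Rᵐᵒᵖ M]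
    [Module.Projective Rᵐᵒᵖ M] : ∃ (n : ℕ) (c : Fin n → M →ₗ[Rᵐᵒᵖ] R) (m : Fin n → M),
      ∀ x, x = ∑ k, MulOpposite.op (c k x) • m k := by
  obtain ⟨n, f, hf⟩ := Module.Finite.exists_fin' Rᵐᵒᵖ M
  obtain ⟨s, hs⟩ := Module.projective_lifting_property f LinearMap.id hf
  refine ⟨n, fun k => (MulOpposite.opLinearEquiv Rᵐᵒᵖ : R ≃ₗ[Rᵐᵒᵖ] Rᵐᵒᵖ).symm.toLinearMap ∘ₗ
    LinearMap.proj k ∘ₗ s, fun k => f (Pi.single k 1), fun x => ?_⟩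
  have h1 : s x = ∑ k, s x k • (Pi.single k 1 : Fin n → Rᵐᵒᵖ) := pi_eq_sum_univ' _
  have h2 := LinearMap.congr_fun hs x
  rw [LinearMap.comp_apply, h1, map_sum] at h2
  simp only [map_smul] at h2
  exact h2.symm

/-- The evaluation map into the double dual. -/
def evalMap (M : Type u) [AddCommGroup M] [Module Rᵐᵒᵖ M] :
    M →ₗ[Rᵐᵒᵖ] ((M →ₗ[Rᵐᵒᵖ] R) →ₗ[R] R) where
  toFun m :=
    { toFun := fun φ => φ m
      map_add' := fun _ _ => rfl
      map_smul' := fun _ _ => rfl }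
  map_add' m m' := LinearMap.ext fun φ => map_add φ m m'
  map_smul' r m := LinearMap.ext fun φ => map_smul φ r m

lemma evalMap_bijective (M : Type u) [AddCommGroup M] [Module Rᵐᵒᵖ M] [Module.Finite Rᵐᵒᵖ M]
    [Module.Projective Rᵐᵒᵖ M] : Function.Bijective (evalMap (R := R) M) := by
  obtain ⟨n, c, m, hc⟩ := exists_dual_basis (R := R) M
  constructor
  · refine (injective_iff_map_eq_zero _).2 fun x hx => ?_
    have h0 : ∀ k, c k x = 0 := fun k => LinearMap.congr_fun hx (c k)
    rw [hc x]
    simp [h0]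
  · intro Θ
    refine ⟨∑ k, MulOpposite.op (Θ (c k)) • m k, LinearMap.ext fun φ => ?_⟩
    have hφ : φ = ∑ k, φ (m k) • c k := by
      ext x
      conv_lhs => rw [hc x]
      simp
    change φ (∑ k, MulOpposite.op (Θ (c k)) • m k) = Θ φ
    conv_rhs => rw [hφ]
    simp

/-- The evaluation isomorphism of a finitely generated projective module with its double dual. -/
def evalEquiv (M : Type u) [AddCommGroup M] [Module Rᵐᵒᵖ M] [Module.Finite Rᵐᵒᵖ M]
    [Module.Projective Rᵐᵒᵖ M] : M ≃ₗ[Rᵐᵒᵖ] ((M →ₗ[Rᵐᵒᵖ] R) →ₗ[R] R) :=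
  LinearEquiv.ofBijective (evalMap M) (evalMap_bijective M)

lemma extVanish_double_dual_iff {M N : Type u} [AddCommGroup M] [Module Rᵐᵒᵖ M]
    [Module.Finite Rᵐᵒᵖ M] [Module.Projective Rᵐᵒᵖ M] [AddCommGroup N] [Module Rᵐᵒᵖ N]
    [Module.Finite Rᵐᵒᵖ N] [Module.Projective Rᵐᵒᵖ N] (d : M →ₗ[Rᵐᵒᵖ] N) (j : ℕ) :
    ExtVanish (A := Rᵐᵒᵖ) R (j + 1) (((N →ₗ[Rᵐᵒᵖ] R) →ₗ[R] R) ⧸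
      LinearMap.range (LinearMap.lcomp Rᵐᵒᵖ R (LinearMap.lcomp R R d))) ↔
      ExtVanish (A := Rᵐᵒᵖ) R (j + 1) (N ⧸ LinearMap.range d) := by
  refine (extVanish_congr (Submodule.Quotient.equiv _ _ (evalEquiv (R := R) N) ?_) j).symm
  have h : LinearMap.lcomp Rᵐᵒᵖ R (LinearMap.lcomp R R d) ∘ₗ (evalEquiv (R := R) M).toLinearMap =
      (evalEquiv (R := R) N).toLinearMap ∘ₗ d := rfl
  rw [← LinearMap.range_comp, ← h, LinearMap.range_comp, LinearEquiv.range, Submodule.map_top]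

/-- Evaluation identifies the differentials of the double dual with those of `X`; the double
negations come from dualizing degrees twice. -/
lemma isTorsionfree_dual_iff (n : ℕ) (X : KProj Rᵐᵒᵖ) :
    IsTorsionfree R Rᵐᵒᵖ R n (dual Rᵐᵒᵖ R R X) ↔ UpTo (CokerExtVanish R) n X := by
  constructor
  · intro h j h1 h2 i k hik
    obtain ⟨j, rfl⟩ := Nat.exists_eq_add_of_le' h1
    obtain ⟨a, rfl⟩ : ∃ a, k = - -a := ⟨k, by lia⟩
    obtain rfl : i = - -(a - 1) := by lia
    exact (extVanish_double_dual_iff (lin (X.as.d (- -(a - 1)) (- -a))) j).1 (h a _ h1 h2)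
  · intro h i j h1 h2
    obtain ⟨j, rfl⟩ := Nat.exists_eq_add_of_le' h1
    exact (extVanish_double_dual_iff (lin (X.as.d (- -(i - 1)) (- -i))) j).2
      (h _ h1 h2 _ _ (by lia))

end Reflexive

end StableComplex

/-! ### Mapping cones and the behaviour of `O` under syzygies -/

namespace StableComplex

open RelativeSyzygy

lemma exists_iso_cone {A : Type u} [Ring A] {X Y : CochainComplex (FGProj A) ℤ} (f : X ⟶ Y)
    {Z : KProj A} {g : toK Y ⟶ Z} {δ : Z ⟶ (toK X)⟦(1 : ℤ)⟧}
    (hT : Triangle.mk (toKMap f) g δ ∈ distTriang (KProj A)) :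
    ∃ e : Z ≅ toK (CochainComplex.mappingCone f),
      g ≫ e.hom = toKMap (CochainComplex.mappingCone.inr f) := by
  obtain ⟨δ', hT'⟩ := exists_cone_distinguished f
  obtain ⟨e, -, h2⟩ := exists_iso_of_arrow_iso _ _ hT hT' (Iso.refl _)
  refine ⟨Triangle.π₃.mapIso e, ?_⟩
  exact e.hom.comm₂.trans ((congrArg (· ≫ _) h2).trans (Category.id_comp _))

section Cone

variable {A : Type u} [Ring A] {X Y : CochainComplex (FGProj A) ℤ} (f : X ⟶ Y)

open CochainComplex

/-- The decomposition of the terms of a mapping cone. -/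
def coneEquiv (i k : ℤ) (h : i + 1 = k) :
    ((mappingCone f).X i).obj ≃ₗ[A] (X.X k).obj × (Y.X i).obj where
  toLinearMap := (lin ((mappingCone.fst f).1.v i k h)).prod
    (lin ((mappingCone.snd f).v i i (add_zero i)))
  invFun z := lin ((mappingCone.inl f).v k i (by lia)) z.1 + lin ((mappingCone.inr f).f i) z.2
  left_inv z := congrArg (fun g => lin g z) (mappingCone.id_X f i k h)
  right_inv z := by
    have h1 := congrArg (fun g => lin g z.1) (mappingCone.inl_v_fst_v f k i h)
    have h2 := congrArg (fun g => lin g z.2) (mappingCone.inr_f_fst_v f i k h)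
    have h3 := congrArg (fun g => lin g z.1) (mappingCone.inl_v_snd_v f k i (by lia))
    have h4 := congrArg (fun g => lin g z.2) (mappingCone.inr_f_snd_v f i)
    simp only [lin_comp_apply, lin_id_apply, lin_zero, LinearMap.zero_apply] at h1 h2 h3 h4
    change (lin _ _, lin _ _) = z
    rw [map_add, map_add, h1, h2, h3, h4, add_zero, zero_add]

lemma coneEquiv_inr (i k : ℤ) (h : i + 1 = k) (y : (Y.X i).obj) :
    coneEquiv f i k h (lin ((mappingCone.inr f).f i) y) = (0, y) := by
  rw [← LinearEquiv.eq_symm_apply]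
  exact (zero_add _).symm.trans (congrArg (· + _) (map_zero _).symm)

lemma coneEquiv_d (i k m : ℤ) (hi : i + 1 = k) (hk : k + 1 = m)
    (z : ((mappingCone f).X i).obj) :
    coneEquiv f k m hk (lin ((mappingCone f).d i k) z) =
      (-lin (X.d k m) (coneEquiv f i k hi z).1,
        lin (f.f k) (coneEquiv f i k hi z).1 + lin (Y.d i k) (coneEquiv f i k hi z).2) :=
  Prod.ext (congrArg (fun g => lin g z) (mappingCone.d_fst_v f i k m hi hk))
    (congrArg (fun g => lin g z) (mappingCone.d_snd_v f i k hi))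

end Cone

section ProjectiveCoker

variable {A : Type u} [Ring A]

lemma projective_quotient_range {M N : Type u} [AddCommGroup M] [Module A M] [AddCommGroup N]
    [Module A N] [Module.Projective A N] {a : M →ₗ[A] N} (s : N →ₗ[A] M)
    (h : ∀ x, a (s (a x)) = a x) : Module.Projective A (N ⧸ LinearMap.range a) := by
  refine Module.Projective.of_split ((LinearMap.range a).liftQ (LinearMap.id - a ∘ₗ s) ?_)
    (LinearMap.range a).mkQ ?_
  · rintro _ ⟨x, rfl⟩
    simp [h]
  · ext x
    simp

end ProjectiveCoker

section Syzygies

variable {A : Type u} [Ring A] {E : Type u} [AddCommGroup E] [Module A E]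

/-- `hp` says that each cycle of `G` is a boundary plus the image of a cycle of `P`, and splitness
makes the cokernels of `P` projective. Degree `k` of the cone is compared with degree `k + 1` of
`G`. -/
lemma cokerExtVanish_cone_iff {P G : CochainComplex (FGProj A) ℤ} (hP : IsSplit (toK P))
    (p : P ⟶ G) (hp : CohZero (CochainComplex.mappingCone.inr p)) (j : ℕ) :
    CokerExtVanish E (j + 1) (toK (CochainComplex.mappingCone p)) ↔
      CokerExtVanish E (j + 2) (toK G) := by
  obtain ⟨s, hs⟩ := isSplit_iff.1 hP
  have key : ∀ i k m : ℤ, i + 1 = k → k + 1 = m →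
      (ExtVanish (A := A) E (j + 1) (((CochainComplex.mappingCone p).X k).obj ⧸
        LinearMap.range (lin ((CochainComplex.mappingCone p).d i k))) ↔
      ExtVanish (A := A) E (j + 2) ((G.X m).obj ⧸ LinearMap.range (lin (G.d k m)))) := by
    intro i k m hik hkm
    have hproj : Module.Projective A ((P.X m).obj ⧸ LinearMap.range (-lin (P.d k m))) :=
      projective_quotient_range (-lin (s m k)) fun x => by simp [hs k m hkm]
    refine extVanish_coker_cone_iff (-lin (P.d k m)) (lin (p.f k)) (lin (G.d i k)) (lin (G.d k m))
      (fun g => ⟨fun hg => ?_, ?_⟩) _ (coneEquiv p k m hkm) (fun z => ⟨?_, ?_⟩) j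
    · obtain ⟨z, hz⟩ := (cohZero_iff_of_rel _).1 hp k m i hkm hik g hg
      have h := (coneEquiv_d p i k m hik hkm z).symm.trans
        ((congrArg _ hz).trans (coneEquiv_inr p k m hkm g))
      exact ⟨_, _, congrArg Prod.fst h, (congrArg Prod.snd h).symm⟩
    · rintro ⟨x, y, hx, rfl⟩
      rw [LinearMap.neg_apply, neg_eq_zero] at hx
      rw [map_add, lin_comm, hx, lin_d_lin_d, map_zero, zero_add]
    · rintro ⟨w, rfl⟩
      exact ⟨_, _, coneEquiv_d p i k m hik hkm w⟩
    · rintro ⟨x, y, h⟩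
      refine ⟨(coneEquiv p i k hik).symm (x, y), (coneEquiv p k m hkm).injective ?_⟩
      rw [coneEquiv_d p i k m hik hkm, LinearEquiv.apply_symm_apply, h]
      rfl
  constructor
  · intro h k m hkm
    exact (key (k - 1) k m (by lia) hkm).1 (h (k - 1) k (by lia))
  · intro h i k hik
    exact (key i k (k + 1) hik rfl).2 (h k (k + 1) rfl)

lemma cokerExtVanish_succ_iff (j : ℕ) {W G : KProj A} (h : IsRelSyzygy (IsSplit (A := A)) W G) :
    CokerExtVanish E (j + 1) W ↔ CokerExtVanish E (j + 2) G := by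
  obtain ⟨P, hP, q, p, δ, hT, hδ⟩ := h
  obtain ⟨P, rfl⟩ := HomotopyCategory.quotient_obj_surjective P
  obtain ⟨G, rfl⟩ := HomotopyCategory.quotient_obj_surjective G
  obtain ⟨p, rfl⟩ := toKMap_surjective p
  obtain ⟨e, he⟩ := exists_iso_cone p (rotate_distinguished hT)
  rw [← cokerExtVanish_shift, cokerExtVanish_congr e]
  refine cokerExtVanish_cone_iff hP p ((isGhost_toKMap_iff _).1 ?_) j
  rw [← he]
  exact hδ.comp_right _

end Syzygies

/-! ### Functionals, and `O 1` as the vanishing of ghosts into split complexes -/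

section Functionals

variable {R : Type u} [Ring R]

lemma eq_zero_of_functionals {M : Type u} [AddCommGroup M] [Module Rᵐᵒᵖ M]
    [Module.Finite Rᵐᵒᵖ M] [Module.Projective Rᵐᵒᵖ M] {x : M}
    (h : ∀ α : M →ₗ[Rᵐᵒᵖ] R, α x = 0) : x = 0 := by
  obtain ⟨n, c, m, hc⟩ := exists_dual_basis (R := R) M
  rw [hc x]
  simp [h]

/-- A dual basis of `Q` reduces the extension problem to its coordinates, which are functionals. -/
lemma exists_extension {M N Q : Type u} [AddCommGroup M] [Module Rᵐᵒᵖ M] [AddCommGroup N]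
    [Module Rᵐᵒᵖ N] [AddCommGroup Q] [Module Rᵐᵒᵖ Q] [Module.Finite Rᵐᵒᵖ Q]
    [Module.Projective Rᵐᵒᵖ Q] (u : M →ₗ[Rᵐᵒᵖ] N) (K : Set M)
    (H : ∀ φ : M →ₗ[Rᵐᵒᵖ] R, (∀ x ∈ K, φ x = 0) → ∃ ψ : N →ₗ[Rᵐᵒᵖ] R, ∀ x, ψ (u x) = φ x)
    (φ : M →ₗ[Rᵐᵒᵖ] Q) (hφ : ∀ x ∈ K, φ x = 0) : ∃ ψ : N →ₗ[Rᵐᵒᵖ] Q, ∀ x, ψ (u x) = φ x := by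
  obtain ⟨n, c, m, hc⟩ := exists_dual_basis (R := R) Q
  choose ψ hψ using fun k => H (c k ∘ₗ φ) fun x hx => (congrArg (c k) (hφ x hx)).trans (map_zero _)
  refine ⟨∑ k, LinearMap.toSpanSingleton Rᵐᵒᵖ Q (m k) ∘ₗ
    (MulOpposite.opLinearEquiv Rᵐᵒᵖ : R ≃ₗ[Rᵐᵒᵖ] Rᵐᵒᵖ).toLinearMap ∘ₗ ψ k, fun x => ?_⟩
  rw [hc (φ x)]
  simp [hψ]

variable {X Y : CochainComplex (FGProj Rᵐᵒᵖ) ℤ}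

/-- The functionals on the terms of a complex which are all zero except for one. -/
def functionalFamily (i : ℤ) (α : (X.X i).obj →ₗ[Rᵐᵒᵖ] R) : ∀ k, (X.X k).obj →ₗ[Rᵐᵒᵖ] R :=
  Function.update (fun _ => 0) i α

lemma functionalFamily_self (i : ℤ) (α : (X.X i).obj →ₗ[Rᵐᵒᵖ] R) :
    functionalFamily i α i = α :=
  Function.update_self ..

lemma functionalFamily_of_ne {i k : ℤ} (α : (X.X i).obj →ₗ[Rᵐᵒᵖ] R) (h : k ≠ i) :
    functionalFamily i α k = 0 :=
  Function.update_of_ne h ..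

/-- The chain map from a complex to the regular modules with zero differential which is given by a
single functional. -/
def functional (i : ℤ) (α : (X.X i).obj →ₗ[Rᵐᵒᵖ] R) (h : ∀ l x, α (lin (X.d l i) x) = 0) :
    X ⟶ zeroCpx fun _ => fgProj (A := Rᵐᵒᵖ) R :=
  toZeroCpx _ (functionalFamily i α) fun l k x => by
    by_cases hk : k = i
    · subst hk
      exact (LinearMap.congr_fun (functionalFamily_self k α) _).trans (h l x)
    · exact LinearMap.congr_fun (functionalFamily_of_ne α hk) _

lemma functional_apply (i : ℤ) (α : (X.X i).obj →ₗ[Rᵐᵒᵖ] R) (h) (x : (X.X i).obj) :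
    lin ((functional i α h).f i) x = α x :=
  LinearMap.congr_fun (functionalFamily_self i α) x

lemma functional_eq_zero (i k : ℤ) (α : (X.X i).obj →ₗ[Rᵐᵒᵖ] R) (h) (x : (X.X k).obj)
    (hx : ∀ y : (X.X i).obj, k = i → HEq x y → α y = 0) :
    lin ((functional i α h).f k) x = 0 := by
  by_cases hk : k = i
  · subst hk
    rw [functional_apply]
    exact hx x rfl HEq.rfl
  · exact LinearMap.congr_fun (functionalFamily_of_ne α hk) x

/-- If `f` is a ghost, `(1 - d s) f` kills cycles, so by Ext vanishing it extends along `d`, which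
yields a null-homotopy. Conversely, a functional vanishing on cycles is a ghost into a complex with
zero differential, and a null-homotopy of it is an extension along `d`. -/
lemma cokerExtVanish_one_iff (G : KProj Rᵐᵒᵖ) :
    CokerExtVanish R 1 G ↔
      ∀ ⦃P⦄, IsSplit P → ∀ f : G ⟶ P, IsGhost (IsSplit (A := Rᵐᵒᵖ)) f → f = 0 := by
  obtain ⟨G, rfl⟩ := HomotopyCategory.quotient_obj_surjective G
  constructor
  · intro h P hP f hf
    obtain ⟨P, rfl⟩ := HomotopyCategory.quotient_obj_surjective P
    obtain ⟨f, rfl⟩ := toKMap_surjective f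
    rw [isGhost_toKMap_iff] at hf
    obtain ⟨s, hs⟩ := isSplit_iff.1 hP
    have h1 : ∀ k i, ∃ g : G.X k ⟶ P.X i, ∀ l, i + 1 = k → l + 1 = i → ∀ x,
        lin g (lin (G.d i k) x) = lin (f.f i) x - lin (P.d l i) (lin (s i l) (lin (f.f i) x)) := by
      intro k i
      by_cases hik : i + 1 = k
      · obtain ⟨g, hg⟩ := exists_extension (lin (G.d i k)) {x | lin (G.d i k) x = 0}
          ((extVanish_one_coker_iff _).1 (h i k hik))
          (lin (f.f i) - lin (P.d (i - 1) i) ∘ₗ lin (s i (i - 1)) ∘ₗ lin (f.f i)) fun x hx => by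
            obtain ⟨y, hy⟩ := (cohZero_iff_of_rel f).1 hf i k (i - 1) hik (by lia) x hx
            simp only [LinearMap.sub_apply, LinearMap.comp_apply]
            rw [← hy, hs (i - 1) i (by lia), sub_self]
        refine ⟨ofLin g, fun l _ hl x => ?_⟩
        obtain rfl : l = i - 1 := by lia
        exact hg x
      · exact ⟨0, fun _ h => absurd h hik⟩
    choose g hg using h1
    refine (toKMap_eq_zero_iff f).2
      ⟨fun i l => f.f i ≫ s i l + g i l - g i l ≫ P.d l i ≫ s i l, fun i k l hik hli x => ?_⟩
    have h1 := hg k i l hik hli x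
    have h2 := hs l i hli (lin (g i l) x)
    simp only [lin_comp_apply, lin_add_apply, lin_sub_apply, map_add, map_sub, h1, h2, lin_comm,
      lin_d_lin_d, sub_zero, map_zero]
    abel
  · intro h i k hik
    refine (extVanish_one_coker_iff _).2 fun φ hφ => ?_
    let f := functional (X := G) i φ fun l x => hφ _ (lin_d_lin_d _ _ _ _)
    obtain ⟨κ, hκ⟩ := (toKMap_eq_zero_iff f).1 (h (isSplit_zeroCpx _) (toKMap f)
      ((isGhost_toKMap_iff f).2 fun a l hl x hx => ⟨0, (map_zero _).trans
        (functional_eq_zero _ _ _ _ _ fun y hy hxy => by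
          subst hy; obtain rfl := eq_of_heq hxy; exact hφ x (hx k)).symm⟩))
    exact ⟨lin (κ k i), fun x => (((functional_apply i φ _ x).symm.trans
      (hκ i k (i - 1) hik (by lia) x)).trans (add_zero _)).symm⟩

end Functionals

end StableComplex

/-! ### The dual side: `T` under cosyzygies, and left approximations -/

namespace StableComplex

open RelativeSyzygy

section DualCone

variable {A B E : Type u} [Ring A] [Ring B] [AddCommGroup E] [Module A E] [Module B E]
  [SMulCommClass A B E]

/-- The decomposition of the dual of a direct sum. -/
def dualProdEquiv {C M N : Type u} [AddCommGroup C] [Module A C] [AddCommGroup M] [Module A M]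
    [AddCommGroup N] [Module A N] (e : C ≃ₗ[A] M × N) :
    (C →ₗ[A] E) ≃ₗ[B] (N →ₗ[A] E) × (M →ₗ[A] E) where
  toLinearMap := (LinearMap.lcomp B E (e.symm.toLinearMap ∘ₗ LinearMap.inr A M N)).prod
    (LinearMap.lcomp B E (e.symm.toLinearMap ∘ₗ LinearMap.inl A M N))
  invFun z := z.1 ∘ₗ LinearMap.snd A M N ∘ₗ e.toLinearMap +
    z.2 ∘ₗ LinearMap.fst A M N ∘ₗ e.toLinearMap
  left_inv α := by
    ext x
    change α (e.symm (0, (e x).2)) + α (e.symm ((e x).1, 0)) = α x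
    rw [← map_add, ← map_add]
    simp
  right_inv z := by
    refine Prod.ext (LinearMap.ext fun x => ?_) (LinearMap.ext fun x => ?_)
    · change z.1 (e (e.symm (0, x))).2 + z.2 (e (e.symm (0, x))).1 = z.1 x
      simp
    · change z.1 (e (e.symm (x, 0))).2 + z.2 (e (e.symm (x, 0))).1 = z.2 x
      simp

variable [Module.Finite B E] [Module.Projective B E]

/-- The dual of the cone is again of cone form, with the roles of the summands exchanged. `hq` says
that every cocycle of the dual of `W` comes from a cocycle of the dual of `Q`, up to a coboundary.
-/
lemma dualCokerExtVanish_cone_iff {W Q : CochainComplex (FGProj A) ℤ} (hQ : IsSplit (toK Q))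
    (q : W ⟶ Q) (hq : ∀ i k : ℤ, i + 1 = k → ∀ α : (W.X k).obj →ₗ[A] E,
      (∀ x, α (lin (W.d i k) x) = 0) → ∃ (β : (Q.X k).obj →ₗ[A] E)
        (γ : (W.X (k + 1)).obj →ₗ[A] E), (∀ x, β (lin (Q.d i k) x) = 0) ∧
          ∀ x, α x = β (lin (q.f k) x) - γ (lin (W.d k (k + 1)) x)) (j : ℕ) :
    DualCokerExtVanish A B E (j + 1) (toK (CochainComplex.mappingCone q)) ↔
      DualCokerExtVanish A B E (j + 2) (toK W) := by
  obtain ⟨s, hs⟩ := isSplit_iff.1 hQ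
  refine forall_congr' fun i => forall_congr' fun k => forall_congr' fun hik => ?_
  have hproj : Module.Projective B (((Q.X i).obj →ₗ[A] E) ⧸
      LinearMap.range (LinearMap.lcomp B E (lin (Q.d i k)))) :=
    projective_quotient_range (LinearMap.lcomp B E (lin (s k i))) fun φ =>
      LinearMap.ext fun x => congrArg φ (hs i k hik x)
  have hD : ∀ (z : ((Q.X k).obj →ₗ[A] E) × ((W.X (k + 1)).obj →ₗ[A] E)),
      dualProdEquiv (B := B) (E := E) (coneEquiv q i k hik) (LinearMap.lcomp B E
        (lin ((CochainComplex.mappingCone q).d i k))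
          ((dualProdEquiv (B := B) (E := E) (coneEquiv q k (k + 1) rfl)).symm z)) =
        (LinearMap.lcomp B E (lin (Q.d i k)) z.1, LinearMap.lcomp B E (lin (q.f k)) z.1 +
          -LinearMap.lcomp B E (lin (W.d k (k + 1))) z.2) := fun z => by
    rw [← LinearEquiv.eq_symm_apply]
    ext x
    change z.1 (coneEquiv q k (k + 1) rfl (lin _ x)).2 +
      z.2 (coneEquiv q k (k + 1) rfl (lin _ x)).1 = z.1 (lin (Q.d i k) (coneEquiv q i k hik x).2) +
        (z.1 (lin (q.f k) (coneEquiv q i k hik x).1) +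
          -z.2 (lin (W.d k (k + 1)) (coneEquiv q i k hik x).1))
    rw [coneEquiv_d q i k (k + 1) hik rfl, map_add, map_neg]
    abel
  refine extVanish_coker_cone_iff (A := B) (LinearMap.lcomp B E (lin (Q.d i k)))
    (LinearMap.lcomp B E (lin (q.f k))) (-LinearMap.lcomp B E (lin (W.d k (k + 1))))
    (LinearMap.lcomp B E (lin (W.d i k))) (fun α => ⟨fun hα => ?_, ?_⟩) _
    (dualProdEquiv (coneEquiv q i k hik)) (fun α => ⟨?_, ?_⟩) j
  · obtain ⟨β, γ, hβ, h⟩ := hq i k hik α fun x => LinearMap.congr_fun hα x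
    exact ⟨β, γ, LinearMap.ext hβ, LinearMap.ext fun x => (h x).trans (sub_eq_add_neg _ _)⟩
  · rintro ⟨β, γ, hβ, rfl⟩
    ext x
    have h1 := LinearMap.congr_fun hβ (lin (q.f i) x)
    change β (lin (Q.d i k) (lin (q.f i) x)) = 0 at h1
    change β (lin (q.f k) (lin (W.d i k) x)) + -γ (lin (W.d k (k + 1)) (lin (W.d i k) x)) = 0
    rw [← lin_comm, h1, lin_d_lin_d, map_zero, neg_zero, add_zero]
  · rintro ⟨β, rfl⟩
    obtain ⟨z, rfl⟩ := (dualProdEquiv (B := B) (coneEquiv q k (k + 1) rfl)).symm.surjective β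
    exact ⟨z.1, z.2, hD z⟩
  · rintro ⟨β, γ, h⟩
    exact ⟨(dualProdEquiv (coneEquiv q k (k + 1) rfl)).symm (β, γ),
      (dualProdEquiv (B := B) (coneEquiv q i k hik)).injective ((hD (β, γ)).trans h.symm)⟩

end DualCone

section Dual

variable {R : Type u} [Ring R]

lemma dualCokerExtVanish_succ_iff (j : ℕ) {W Z : KProj Rᵐᵒᵖ}
    (h : IsStrongSyzygy (IsSplit (A := Rᵐᵒᵖ)) W Z) :
    DualCokerExtVanish Rᵐᵒᵖ R R (j + 1) Z ↔ DualCokerExtVanish Rᵐᵒᵖ R R (j + 2) W := by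
  obtain ⟨Q, q, g, δ, hT, -, hQ, hq⟩ := h
  obtain ⟨W, rfl⟩ := HomotopyCategory.quotient_obj_surjective W
  obtain ⟨Q, rfl⟩ := HomotopyCategory.quotient_obj_surjective Q
  obtain ⟨q, rfl⟩ := toKMap_surjective q
  obtain ⟨e, -⟩ := exists_iso_cone q hT
  refine Iff.trans ⟨fun h => h.of_iso e.symm, fun h => h.of_iso e⟩
    (dualCokerExtVanish_cone_iff hQ q (fun i k hik α hα => ?_) j)
  let f := functional (X := W) k α fun l x => by
    by_cases hl : l + 1 = k
    · obtain rfl : l = i := by lia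
      exact hα x
    · rw [W.shape l k hl]
      exact map_zero α
  obtain ⟨h, hh⟩ := hq (isSplit_zeroCpx _) (toKMap f)
  obtain ⟨h, rfl⟩ := toKMap_surjective h
  rw [← toKMap_comp] at hh
  obtain ⟨κ, hκ⟩ := exists_homotopy_of_toKMap_eq hh.symm
  refine ⟨lin (h.f k), -lin (κ (k + 1) k), fun x => (lin_comm h i k x).symm, fun x => ?_⟩
  have h1 := (functional_apply k α _ x).symm.trans (hκ k (k + 1) i rfl hik x)
  refine h1.trans ?_
  change lin (κ (k + 1) k) (lin (W.d k (k + 1)) x) + 0 + lin (h.f k) (lin (q.f k) x) =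
    lin (h.f k) (lin (q.f k) x) - -lin (κ (k + 1) k) (lin (W.d k (k + 1)) x)
  abel

/-- By reflexivity, functionals on the dual modules are elements, so the extension criterion for
`Ext¹` becomes a criterion for being a boundary. -/
lemma dualCokerExtVanish_one_iff_exists (W : KProj Rᵐᵒᵖ) :
    DualCokerExtVanish Rᵐᵒᵖ R R 1 W ↔ ∀ i k : ℤ, i + 1 = k → ∀ w : (W.as.X k).obj,
      (∀ α : (W.as.X k).obj →ₗ[Rᵐᵒᵖ] R, (∀ v, α (lin (W.as.d i k) v) = 0) → α w = 0) →
        ∃ v, lin (W.as.d i k) v = w := by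
  refine forall_congr' fun i => forall_congr' fun k => forall_congr' fun hik => ?_
  rw [extVanish_one_coker_iff (A := R)]
  constructor
  · intro h w hw
    obtain ⟨ψ, hψ⟩ := h (evalMap _ w) fun α hα => hw α fun v => LinearMap.congr_fun hα v
    obtain ⟨v, rfl⟩ := (evalMap_bijective (R := R) (W.as.X i).obj).2 ψ
    exact ⟨v, (evalMap_bijective (R := R) (W.as.X k).obj).1 (LinearMap.ext hψ)⟩
  · intro h φ hφ
    obtain ⟨w, rfl⟩ := (evalMap_bijective (R := R) (W.as.X k).obj).2 φ
    obtain ⟨v, rfl⟩ := h w fun α hα => hφ α (LinearMap.ext hα)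
    exact ⟨evalMap _ v, fun α => rfl⟩

lemma eq_zero_of_unitGen {A : Type u} [Ring A] {X : CochainComplex (FGProj A) ℤ} (i : ℤ)
    (f : (HomologicalComplex.single (FGProj A) (ComplexShape.up ℤ) i).obj (regular A) ⟶ X)
    (h : lin (f.f i) (unitGen A i) = 0) : f = 0 := by
  rw [eq_fromUnit i f, eq_fromUnit i 0]
  congr 1

lemma toKMap_eq_zero_of_retract {A : Type u} [Ring A] [IsNoetherianRing A] {X : KProj A}
    {P : KProj A} (hP : IsSplit P) (f : X ⟶ P)
    (h : ∀ (n : ℤ → ℕ) (g : P ⟶ toK (freeCpx A n)), f ≫ g = 0) : f = 0 := by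
  obtain ⟨n, ⟨r⟩⟩ := (isSplit_iff_retract P).1 hP
  rw [← Category.comp_id f, ← r.retract, ← Category.assoc, h n r.i, zero_comp]

/-- A functional vanishing on boundaries is a map to a split complex, so maps killed by all of these
send cycles to boundaries. Conversely, an element killed by all such functionals is a cycle, and the
map it defines from a shifted regular module is of this kind. -/
lemma dualCokerExtVanish_one_iff [IsNoetherianRing Rᵐᵒᵖ] (W : KProj Rᵐᵒᵖ) :
    DualCokerExtVanish Rᵐᵒᵖ R R 1 W ↔ ∀ ⦃P⦄, IsSplit P → ∀ f : P ⟶ W,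
      (∀ ⦃P'⦄, IsSplit P' → ∀ g : W ⟶ P', f ≫ g = 0) → f = 0 := by
  rw [dualCokerExtVanish_one_iff_exists]
  obtain ⟨W, rfl⟩ := HomotopyCategory.quotient_obj_surjective W
  constructor
  · intro h P hP f hf
    obtain ⟨P, rfl⟩ := HomotopyCategory.quotient_obj_surjective P
    obtain ⟨f, rfl⟩ := toKMap_surjective f
    refine CohZero.toKMap_eq_zero (fun i l hl x hx => h l i hl (lin (f.f i) x) fun α hα => ?_) hP
    let g := functional (X := W) i α fun l' x => by
      by_cases hl' : l' + 1 = i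
      · obtain rfl : l' = l := by lia
        exact hα x
      · rw [W.shape l' i hl']
        exact map_zero α
    have h0 := hf (isSplit_zeroCpx _) (toKMap g)
    rw [← toKMap_comp] at h0
    obtain ⟨κ, hκ⟩ := (toKMap_eq_zero_iff _).1 h0
    refine (functional_apply i α _ _).symm.trans ((hκ i (i + 1) l rfl hl x).trans ?_)
    rw [hx, map_zero, zero_add]
    rfl
  · intro h i k hik (w : (W.X k).obj) hw
    have hcyc : ∀ m, lin (W.d k m) w = 0 := fun m => eq_zero_of_functionals (R := R) fun α =>
      hw (α ∘ₗ lin (W.d k m)) fun v => (congrArg α (lin_d_lin_d _ _ _ _)).trans (map_zero α)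
    have h0 : toKMap (fromUnit k w hcyc) = 0 := h (isSplit_unitK k) _ fun P' hP' g =>
      toKMap_eq_zero_of_retract hP' _ fun n g' => by
        rw [Category.assoc]
        obtain ⟨g', hg'⟩ := toKMap_surjective (g ≫ g')
        rw [← hg', ← toKMap_comp, eq_zero_of_unitGen k (fromUnit k w hcyc ≫ g')]
        · exact CategoryTheory.Functor.map_zero _ _ _
        refine (congrArg (lin (g'.f k)) (fromUnit_unitGen k w hcyc)).trans
          (eq_zero_of_functionals (R := R) fun α => hw (α ∘ₗ lin (g'.f k)) fun v => ?_)
        exact (congrArg α (lin_comm g' i k v).symm).trans (map_zero α)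
    exact exists_boundary_of_fromUnit_comp (f := 𝟙 W) k i hik w hcyc (by rw [h0, zero_comp])

/-- The functionals vanishing on boundaries form a submodule of a finitely generated left module; a
finite set of generators gives `q`. This is where the noetherian hypothesis on left modules enters.
-/
lemma exists_generating_functionals [IsNoetherianRing R] (W : CochainComplex (FGProj Rᵐᵒᵖ) ℤ)
    (i : ℤ) : ∃ (n : ℕ) (q : (W.X i).obj →ₗ[Rᵐᵒᵖ] (Fin n → R)),
      (∀ x, q (lin (W.d (i - 1) i) x) = 0) ∧ ∀ φ : (W.X i).obj →ₗ[Rᵐᵒᵖ] R,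
        (∀ x, φ (lin (W.d (i - 1) i) x) = 0) → ∃ ψ : (Fin n → R) →ₗ[Rᵐᵒᵖ] R, ∀ x, ψ (q x) = φ x := by
  let K := LinearMap.ker (LinearMap.lcomp R R (lin (W.d (i - 1) i)))
  obtain ⟨n, p, hp⟩ := Module.Finite.exists_fin' R K
  refine ⟨n, LinearMap.pi fun j => (p (Pi.single j 1)).1, fun x => ?_, fun φ hφ => ?_⟩
  · ext j
    exact LinearMap.congr_fun (LinearMap.mem_ker.1 (p (Pi.single j 1)).2) x
  · obtain ⟨c, hc⟩ := hp ⟨φ, LinearMap.ext hφ⟩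
    refine ⟨∑ j, c j • LinearMap.proj j, fun x => ?_⟩
    rw [pi_eq_sum_univ' c, map_sum] at hc
    have := LinearMap.congr_fun (congrArg Subtype.val hc) x
    simpa using this

instance finite_op_pi (n : ℕ) : Module.Finite Rᵐᵒᵖ (Fin n → R) := Module.Finite.pi

instance projective_op_pi (n : ℕ) : Module.Projective Rᵐᵒᵖ (Fin n → R) := projective_pi _

lemma exists_leftApprox [IsNoetherianRing R] [IsNoetherianRing Rᵐᵒᵖ] (W : KProj Rᵐᵒᵖ) :
    ∃ (Q : KProj Rᵐᵒᵖ) (q : W ⟶ Q), IsLeftApprox (IsSplit (A := Rᵐᵒᵖ)) q := by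
  obtain ⟨W, rfl⟩ := HomotopyCategory.quotient_obj_surjective W
  choose n q hq hext using exists_generating_functionals W
  let q' : W ⟶ zeroCpx fun i => fgProj (A := Rᵐᵒᵖ) (Fin (n i) → R) :=
    toZeroCpx _ q fun i k x => by
      by_cases hik : i + 1 = k
      · obtain rfl : i = k - 1 := by lia
        exact hq k x
      · rw [W.shape i k hik]
        exact map_zero (q k)
  refine ⟨_, toKMap q', isSplit_zeroCpx _, fun P hP g => ?_⟩
  -- Replacing `P` by a free complex with zero differential makes the factorization a degreewise
  -- problem, with no homotopies.
  obtain ⟨m, ⟨r⟩⟩ := (isSplit_iff_retract P).1 hP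
  obtain ⟨g', hg'⟩ := toKMap_surjective (g ≫ r.i)
  have h1 : ∀ i, ∃ ψ : (Fin (n i) → R) →ₗ[Rᵐᵒᵖ] (Fin (m i) → Rᵐᵒᵖ), ∀ x,
      ψ (q i x) = lin (g'.f i) x := fun i => by
    refine exists_extension (R := R) (q i) (Set.range (lin (W.d (i - 1) i)))
      (fun φ hφ => hext i φ fun x => hφ _ ⟨x, rfl⟩) (lin (g'.f i)) ?_
    rintro _ ⟨x, rfl⟩
    exact (lin_comm g' _ _ x).symm
  choose ψ hψ using h1
  refine ⟨toKMap (fromZeroCpx (X := freeCpx Rᵐᵒᵖ m) _ ψ fun _ _ _ => rfl) ≫ r.r, ?_⟩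
  rw [← Category.assoc, ← toKMap_comp, ← Category.comp_id g, ← r.retract, ← Category.assoc, ← hg']
  congr 2
  ext i : 1
  exact hom_ext_apply (hψ i)

lemma isVanishingPair [IsNoetherianRing R] [IsNoetherianRing Rᵐᵒᵖ] :
    IsVanishingPair (IsSplit (A := Rᵐᵒᵖ)) (CokerExtVanish R) (DualCokerExtVanish Rᵐᵒᵖ R R) where
  iso _ _ _ e h := h.of_iso e.symm
  one_left := cokerExtVanish_one_iff
  one_right := dualCokerExtVanish_one_iff
  succ_left j _ _ h := cokerExtVanish_succ_iff j h
  succ_right j _ _ h := dualCokerExtVanish_succ_iff j h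
  exists_leftApprox := exists_leftApprox

end Dual

end StableComplex

end

theorem theorem5p12 {R : Type u} [Ring R] [IsNoetherianRing R] [IsNoetherianRing Rᵐᵒᵖ]
    (X : StableComplex.KProj Rᵐᵒᵖ) (n : ℕ) (hn : 1 ≤ n) :
    (∃ W : StableComplex.KProj Rᵐᵒᵖ, StableComplex.IsNthSyzygy n X W) ∧
    ∀ W : StableComplex.KProj Rᵐᵒᵖ, StableComplex.IsNthSyzygy n X W →
      (StableComplex.IsTorsionfree Rᵐᵒᵖ R R n W ↔
        ∃ (Y G : StableComplex.KProj Rᵐᵒᵖ) (f : Y ⟶ G) (ψ : G ⟶ X) (δ : X ⟶ Y⟦(1 : ℤ)⟧),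
          StableComplex.IsCohGhost (Triangle.mk f ψ δ) ∧
          StableComplex.IsTorsionfree R Rᵐᵒᵖ R n (StableComplex.dual Rᵐᵒᵖ R R G) ∧
          StableComplex.projDim Y ≤ ((n - 1 : ℕ) : ℕ∞)) := by
  have hS := StableComplex.isShiftAdditive_isSplit (A := Rᵐᵒᵖ)
  refine ⟨StableComplex.exists_isNthSyzygy n X, fun W hW => ?_⟩
  rw [StableComplex.isTorsionfree_iff, StableComplex.isVanishingPair.upTo_nthSyzygy_iff hS
    ((StableComplex.isNthSyzygy_iff n X W).1 hW)]
  refine exists_congr fun Y => exists_congr fun G => ?_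
  simp only [StableComplex.isCohGhost_iff hS, StableComplex.isTorsionfree_dual_iff,
    StableComplex.projDim_le_iff, Nat.sub_add_cancel hn]
  constructor
  · rintro ⟨⟨f, g, δ, h⟩, hG, hY⟩
    exact ⟨f, g, δ, h, hG, hY⟩
  · rintro ⟨f, g, δ, h, hG, hY⟩
    exact ⟨⟨f, g, δ, h⟩, hG, hY⟩
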